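/- **Setting.** A Mars network has a set $V$ of $n_t\ge 2$ ToR switches, each with $n_u$ in/out ports, connected by $n_u$ circuit switches. Each circuit switch cycles through $\Gamma$ perfect matchings of the ToR switches (permutations of $V$), one per timeslot. All links have the same capacity $c>0$, and a fraction $\Delta_u\in[0,1)$ of each timeslot is lost to reconfiguration. The ToR-to-ToR connectivity is a periodic evolving graph with period $\Gamma$. Its emulated graph is the union of the edges over one period: a $d$-regular directed multigraph (loops allowed) with $d=n_u\Gamma\ge 2$, in which an edge of timeslot $\ell$ has $\frac{1-\Delta_u}{\Gamma}$ times its capacity in that timeslot. A demand matrix $\mathcal M=(m_{s,t})$, $m_{s,t}\ge0$, is saturated if every row and column sum equals the total outgoing, respectively incoming, emulated capacity of the node. A VLB flow $F$ (Valiant load balancing) assigns nonnegative amounts to finitely many temporal routes starting in the first period, repeated in every period. A route from $s$ to $t$ consists of a leg $s\to w$ and a leg $w\to t$, where consecutive hops are $1$ to $\Gamma$ timeslots apart, a leg may be empty and may revisit vertices. For each pair $(s,t)$ every $w\in V$ is the intermediate node of exactly a fraction $1/n_t$ of the $s$-$t$ flow, and the capacity of every edge is obeyed at all times. There is no constraint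 on delay or buffers. $F$ serves $\theta\mathcal M$ if for all $s,t$ the total $s$-$t$ flow in the first period, times $\frac{1-\Delta_u}{\Gamma}$, is at least $\theta m_{s,t}$. Let $\theta(\mathcal M)$ be the supremum of the $\theta$ for which some VLB flow serves $\theta\mathcal M$, and $\theta^*=\inf_{\mathcal M}\theta(\mathcal M)$ over the saturated $\mathcal M$. Let $\mathrm{ARL}(\mathcal M,F)=\sum_{s,t}\sum_{p}\frac{m_{s,t}}{M}\,r_p\,\mathrm{len}(p)$, where $M=\sum_{s,t}m_{s,t}$, $p$ runs over the $s$-$t$ routes used by $F$, $r_p$ is the fraction of the $s$-$t$ flow on $p$, and $\mathrm{len}(p)$ is the number of hops. **Theorem 5 (Unconstrained Throughput Upper Bound).** Let every ordered pair of vertices be joined by a walk of at most $D$ edges in the emulated graph, and write $D=\log_d n_t+\varepsilon$ with $\varepsilon\in\mathbb R$. 1. The suprema $\theta(\mathcal M)$ (for saturated $\mathcal M$) and the infimum $\theta^*$ are attained, and $\theta(\mathcal M)=\theta^*$ for every saturated $\mathcal M$. Moreover, $\theta^*\mathcal M$ is served by a VLB flow in which no leg of a route visits a vertex twice. 2. ($\theta^*=1/\mathrm{ARL}$.)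 For every saturated $\mathcal M$, every VLB flow $F$ and every $\theta$ such that $F$ serves $\theta\mathcal M$ satisfy $\theta\le 1/\mathrm{ARL}(\mathcal M,F)$ (with $1/0$ read as $0$). Some VLB flow $F$ serves $\theta^*\mathcal M$ and satisfies $\theta^*=1/\mathrm{ARL}(\mathcal M,F)$. 3. ($\theta^*\approx 1/(2\log_d n_t)$.) $$\Bigl(1-\tfrac1d\Bigr)d^{-\varepsilon}\,\frac{1}{2(\log_d n_t+\varepsilon)}\ \le\ \theta^*,\qquad \theta^*\Bigl(2(\log_d n_t+\varepsilon)-\tfrac{2d^{\varepsilon}d}{(d-1)^2}\Bigr)\le 1,\qquad \theta^*\Bigl(2\log_d n_t-2-\tfrac{2}{(d-1)^2}\Bigr)\le 1 .$$ 4. Suppose the emulated graph is the de Bruijn digraph: vertices $0,\dots,n_t-1$ and edges $u\to ud+a \bmod n_t$ for $0\le a<d$ (with multiplicity). Then $\theta^*\ge \frac{n_t\lfloor d^m/n_t\rfloor}{d^m}\cdot\frac1{2m}$ for every integer $m\ge1$. If moreover $n_t$ is a power of $d$, then for every saturated $\mathcal M$ some VLB flow $F$ serves $\frac{1}{2\log_d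 n_t}\mathcal M$ with $\mathrm{ARL}(\mathcal M,F)=2\log_d n_t$; in particular $\theta^*\ge\frac1{2\log_d n_t}$. -/

import Mathlib

noncomputable section

/-- A periodic evolving graph on the vertex set `V`: a directed graph for every timeslot, with edge
capacities, all periodic with a common period. `latencyTax` is the fraction of every timeslot that
is lost to reconfiguration. -/
structure PeriodicEvolvingGraph (V : Type*) where
  period : ℕ
  period_pos : 0 < period
  edges : ℕ → Set (V × V)
  edges_periodic : ∀ t, edges (t + period) = edges t
  cap : ℕ → V × V → ℝ
  cap_nonneg : ∀ t e, 0 ≤ cap t e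
  cap_periodic : ∀ t e, cap (t + period) e = cap t e
  cap_eq_zero : ∀ t e, e ∉ edges t → cap t e = 0
  latencyTax : ℝ
  latencyTax_nonneg : 0 ≤ latencyTax
  latencyTax_lt_one : latencyTax < 1

/-- A hop `(e, t)`: the directed edge `e` is used in timeslot `t`. -/
abbrev Hop (V : Type*) := (V × V) × ℕ

namespace PeriodicEvolvingGraph

variable {V : Type*} (G : PeriodicEvolvingGraph V)

/-- Average fraction of time in which one labelled edge of the period can be used. -/
def slotShare : ℝ := (1 - G.latencyTax) / G.period

/-- Capacity of the labelled edge `(e, l)`, `l < period`, of the emulated graph. -/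
def emulatedCap (e : V × V) (l : ℕ) : ℝ := G.slotShare * G.cap l e

/-- Total capacity of the outgoing edges of `u` in the emulated graph. -/
def outCapacity [Fintype V] (u : V) : ℝ :=
  ∑ l ∈ Finset.range G.period, ∑ v, G.emulatedCap (u, v) l

/-- Total capacity of the incoming edges of `u` in the emulated graph. -/
def inCapacity [Fintype V] (u : V) : ℝ :=
  ∑ l ∈ Finset.range G.period, ∑ v, G.emulatedCap (v, u) l

/-- Adjacency in the emulated graph (the union of the edge sets over one period). -/
def EmulatedAdj (u v : V) : Prop := ∃ l < G.period, (u, v) ∈ G.edges l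

/-- There is a walk with exactly `k` edges from `u` to `v` in the emulated graph. -/
def EmulatedWalk : ℕ → V → V → Prop
  | 0, u, v => u = v
  | k + 1, u, v => ∃ w, G.EmulatedAdj u w ∧ EmulatedWalk k w v

/-- The diameter of the emulated graph is at most `D`. -/
def EmulatedDiamLE (D : ℕ) : Prop := ∀ u v, ∃ k ≤ D, G.EmulatedWalk k u v

/-- A saturated demand matrix: the demand leaving (entering) every node equals its outgoing
(incoming) capacity. -/
structure IsSaturated [Fintype V] (M : V → V → ℝ) : Prop where
  nonneg : ∀ s t, 0 ≤ M s t
  row : ∀ s, ∑ t, M s t = G.outCapacity s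
  col : ∀ t, ∑ s, M s t = G.inCapacity t

/-- Temporal walks from `s` to `t`: consecutive edges are joined, every edge is present when it is
used, and every edge is used at most one period after its predecessor. -/
def IsTemporalWalk : V → V → List (Hop V) → Prop
  | s, t, [] => s = t
  | s, t, h :: p => h.1 ∈ G.edges h.2 ∧ h.1.1 = s ∧ IsTemporalWalk h.1.2 t p ∧
      ∀ h' ∈ p.head?, h.2 < h'.2 ∧ h'.2 ≤ h.2 + G.period

end PeriodicEvolvingGraph

/-- A route of Valiant load balancing: a first leg from the source to an intermediate node and a
second leg from there to the destination. -/
structure VLBRoute (V : Type*) where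
  src : V
  mid : V
  dst : V
  first : List (Hop V)
  second : List (Hop V)

namespace VLBRoute

variable {V : Type*}

/-- The sequence of hops of the whole route. -/
def hops (r : VLBRoute V) : List (Hop V) := r.first ++ r.second

/-- The number of hops of the whole route. -/
def length (r : VLBRoute V) : ℕ := r.hops.length

/-- The route is legal in `G` and starts in the first period. -/
def IsFoundation (G : PeriodicEvolvingGraph V) (r : VLBRoute V) : Prop :=
  G.IsTemporalWalk r.src r.mid r.first ∧ G.IsTemporalWalk r.mid r.dst r.second ∧
    G.IsTemporalWalk r.src r.dst r.hops ∧ ∀ h ∈ r.hops.head?, h.2 < G.period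

/-- Each of the two legs visits no vertex twice. -/
def HasSimpleLegs (r : VLBRoute V) : Prop :=
  (r.src :: r.first.map (fun h => h.1.2)).Nodup ∧ (r.mid :: r.second.map (fun h => h.1.2)).Nodup

end VLBRoute

/-- A temporal hop sequence, delayed by `τ` timeslots. -/
def delayHops {V : Type*} (τ : ℕ) (p : List (Hop V)) : List (Hop V) :=
  p.map (fun h => (h.1, h.2 + τ))

/-- An assignment of flow to finitely many routes of the first period; it is repeated on the
periodic copies of these routes. -/
abbrev RouteFlow (V : Type*) := VLBRoute V →₀ ℝ

namespace RouteFlow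

open Classical in
/-- Total flow from `s` to `t` on the routes of the first period. -/
def pairFlow {V : Type*} (F : RouteFlow V) (s t : V) : ℝ :=
  ∑ r ∈ F.support with r.src = s ∧ r.dst = t, F r

open Classical in
/-- Total flow from `s` to `t` that is sent through the intermediate node `w`. -/
def viaFlow {V : Type*} (F : RouteFlow V) (s w t : V) : ℝ :=
  ∑ r ∈ F.support with r.src = s ∧ r.mid = w ∧ r.dst = t, F r

open Classical in
/-- Flow on the edge `e` at time `t`, summed over all routes and all their periodic copies
(a copy that is delayed by more than `t` timeslots cannot use an edge at time `t`). -/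
def load {V : Type*} (G : PeriodicEvolvingGraph V) (F : RouteFlow V) (e : V × V) (t : ℕ) : ℝ :=
  ∑ r ∈ F.support, ∑ k ∈ Finset.range (t + 1),
    if (e, t) ∈ delayHops (k * G.period) r.hops then F r else 0

open Classical in
/-- Average route length of a flow for a demand matrix: routes are weighted with the share of their
pair in the total demand and with the fraction of the flow of the pair which they carry. -/
def averageRouteLength {V : Type*} [Fintype V] (M : V → V → ℝ) (F : RouteFlow V) : ℝ :=
  ∑ s, ∑ t, ∑ r ∈ F.support with r.src = s ∧ r.dst = t,
    M s t / (∑ a, ∑ b, M a b) * (F r / F.pairFlow s t) * (r.length : ℝ)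

end RouteFlow

/-- A legal temporal flow under Valiant load balancing: capacities are obeyed at all times, and the
traffic of every source-destination pair is spread evenly over all intermediate nodes. -/
structure IsVLBFlow {V : Type*} [Fintype V] (G : PeriodicEvolvingGraph V) (F : RouteFlow V) :
    Prop where
  nonneg : ∀ r, 0 ≤ F r
  legal : ∀ r ∈ F.support, r.IsFoundation G
  capacity : ∀ e t, F.load G e t ≤ G.cap t e
  balanced : ∀ s w t, F.viaFlow s w t = F.pairFlow s t / Fintype.card V

namespace PeriodicEvolvingGraph

variable {V : Type*} (G : PeriodicEvolvingGraph V)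

/-- The flow `F` satisfies the scaled demand matrix `θ · M` on average over a period. -/
def Serves (F : RouteFlow V) (M : V → V → ℝ) (θ : ℝ) : Prop :=
  ∀ s t, θ * M s t ≤ G.slotShare * F.pairFlow s t

/-- The scaling factors of `M` that can be achieved under Valiant load balancing. -/
def vlbAchievable [Fintype V] (M : V → V → ℝ) : Set ℝ :=
  {θ | ∃ F : RouteFlow V, IsVLBFlow G F ∧ G.Serves F M θ}

/-- Throughput under Valiant load balancing for a given demand matrix. -/
def vlbThroughputFor [Fintype V] (M : V → V → ℝ) : ℝ := sSup (G.vlbAchievable M)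

/-- Throughput under Valiant load balancing for a worst-case saturated demand matrix. -/
def vlbThroughput [Fintype V] : ℝ := sInf (G.vlbThroughputFor '' {M | G.IsSaturated M})

end PeriodicEvolvingGraph

/-- A network of ToR switches `V`, each with `nu` in/out ports, which are connected by `nu` circuit
switches; every circuit switch cycles through `Γ` perfect matchings of the ToR switches, all links
have the same capacity. -/
structure MarsNetwork (V : Type*) (nu Γ : ℕ) where
  matching : Fin nu → Fin Γ → Equiv.Perm V
  linkCap : ℝ
  linkCap_pos : 0 < linkCap
  latencyTax : ℝ
  latencyTax_nonneg : 0 ≤ latencyTax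
  latencyTax_lt_one : latencyTax < 1

namespace MarsNetwork

variable {V : Type*} {nu Γ : ℕ}

/-- The periodic evolving graph of the ToR-to-ToR connectivity. -/
def graph [DecidableEq V] [NeZero Γ] (N : MarsNetwork V nu Γ) : PeriodicEvolvingGraph V where
  period := Γ
  period_pos := Nat.pos_of_ne_zero (NeZero.ne Γ)
  edges t := {e | ∃ i, N.matching i (Fin.ofNat Γ t) e.1 = e.2}
  edges_periodic t := by
    have h : Fin.ofNat Γ (t + Γ) = Fin.ofNat Γ t := by ext; simp
    simp only [h]
  cap t e := N.linkCap * (Finset.univ.filter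
    (fun i => N.matching i (Fin.ofNat Γ t) e.1 = e.2)).card
  cap_nonneg t e := mul_nonneg N.linkCap_pos.le (Nat.cast_nonneg _)
  cap_periodic t e := by
    have h : Fin.ofNat Γ (t + Γ) = Fin.ofNat Γ t := by ext; simp
    simp only [h]
  cap_eq_zero t e he := by
    have h : Finset.univ.filter (fun i => N.matching i (Fin.ofNat Γ t) e.1 = e.2) = ∅ :=
      Finset.filter_eq_empty_iff.mpr fun i _ hi => he ⟨i, hi⟩
    rw [h, Finset.card_empty, Nat.cast_zero, mul_zero]
  latencyTax := N.latencyTax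
  latencyTax_nonneg := N.latencyTax_nonneg
  latencyTax_lt_one := N.latencyTax_lt_one

/-- Number of parallel edges from `u` to `v` in the emulated multigraph, which is regular of degree
`nu * Γ`: it is the union of `nu * Γ` perfect matchings. -/
def multiplicity [DecidableEq V] (N : MarsNetwork V nu Γ) (u v : V) : ℕ :=
  (Finset.univ.filter (fun x : Fin nu × Fin Γ => N.matching x.1 x.2 u = v)).card

/-- The emulated graph is the `d`-regular de Bruijn digraph: after numbering the vertices
`0, …, n - 1`, the edges lead from `u` to `u * d + a` modulo `n` for `a = 0, …, d - 1`. -/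
def EmulatesDeBruijn [Fintype V] [DecidableEq V] (N : MarsNetwork V nu Γ) (d : ℕ) : Prop :=
  ∃ φ : V ≃ Fin (Fintype.card V), ∀ u v,
    N.multiplicity u v = ((Finset.range d).filter
      (fun a => ((φ u : ℕ) * d + a) % Fintype.card V = (φ v : ℕ))).card

end MarsNetwork

end

/-! Write `n` for the number of nodes. A saturated matrix has equal row and column sums, because
each node has `d` outgoing and `d` incoming links of equal capacity. As every pair spreads its
traffic evenly over all intermediate nodes, the first legs of all routes together form a uniform
all-to-all demand, and so do the second legs. Hence all saturated matrices pose the same problem: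
route one unit between every ordered pair of nodes so that the largest load `Λ` of a link is least.
The throughput is `n / (2 d Λ)`; see `exists_flow_of_scheme` and `exists_simple_scheme_of_flow` for
the two directions.

Time plays no role. A walk in the emulated graph can be scheduled greedily, and conversely, once the
routes of the first period have all ended, the load of an edge at time `t` is the flow summed over
all uses of that edge at times congruent to `t` (`load_le_emulatedLoad`,
`exists_emulatedLoad_le_load`). Cutting cycles out of a walk raises no load, so finitely many simple
walks suffice, and compactness yields an optimal scheme (`exists_optimal_scheme`).

Flow times length, summed over all routes, is the total use of links and so at most the total
capacity; this gives `θ ≤ 1 / ARL`. Equality needs every link to be full. The spare capacity of an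
optimal scheme is a circulation, hence it can be used up by closed walks from nodes to themselves,
without loss of throughput (`exists_tight_scheme`).

The bounds on `Λ` come from counting. In a `d`-regular multigraph the walks of length `k` use each
link exactly `k d^(k-1)` times, so one walk of at most `D` edges per pair gives an upper bound. At
most `1 + d + ... + d^k` nodes lie within distance `k` of a node, so walks are long on average,
which gives the lower bound. In the de Bruijn digraph, walking `m` steps appends `m` digits in base
`d`; therefore all pairs are joined by almost equally many walks of length `m`, and using them
evenly gives the sharper estimate. -/

/-! ### Temporal walks and labelled walks in the emulated graph -/

namespace PeriodicEvolvingGraph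

variable {V : Type*} (G : PeriodicEvolvingGraph V)

/-- Walks in the emulated graph, as lists of labelled edges with labels below the period. -/
def IsLabelledWalk : V → V → List (Hop V) → Prop
  | s, t, [] => s = t
  | s, t, h :: p => h.1 ∈ G.edges h.2 ∧ h.2 < G.period ∧ h.1.1 = s ∧ IsLabelledWalk h.1.2 t p

/-- Replaces every time of a hop sequence by its residue modulo the period. -/
def reduceHops (p : List (Hop V)) : List (Hop V) := p.map fun h => (h.1, h.2 % G.period)

/-- The first time from `τ` on with residue `l` modulo the period. -/
def nextSlot (τ l : ℕ) : ℕ := τ + (l + τ * (G.period - 1)) % G.period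

/-- Uses the labelled edges of a walk one after the other, each as early as possible, from `τ` on. -/
def schedule : ℕ → List (Hop V) → List (Hop V)
  | _, [] => []
  | τ, h :: p => (h.1, G.nextSlot τ h.2) :: schedule (G.nextSlot τ h.2 + 1) p

/-- The time after the last hop of `schedule`. -/
def scheduleEnd : ℕ → List (Hop V) → ℕ
  | τ, [] => τ
  | τ, h :: p => scheduleEnd (G.nextSlot τ h.2 + 1) p

variable {G}

theorem edges_mod (t : ℕ) : G.edges (t % G.period) = G.edges t :=
  Function.Periodic.map_mod_nat (f := G.edges) G.edges_periodic t

theorem le_nextSlot (τ l : ℕ) : τ ≤ G.nextSlot τ l := Nat.le_add_right _ _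

theorem nextSlot_lt (τ l : ℕ) : G.nextSlot τ l < τ + G.period :=
  Nat.add_lt_add_left (Nat.mod_lt _ G.period_pos) _

/-- Modulo the period, `τ * (G.period - 1)` is `-τ`; this form avoids truncated subtraction. -/
theorem nextSlot_mod (τ l : ℕ) : G.nextSlot τ l % G.period = l % G.period := by
  obtain ⟨k, hk⟩ : ∃ k, G.period = k + 1 := ⟨G.period - 1, (Nat.sub_add_cancel G.period_pos).symm⟩
  unfold nextSlot
  rw [Nat.add_mod_mod, hk, Nat.add_sub_cancel, show τ + (l + τ * k) = l + τ * (k + 1) by ring,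
    Nat.add_mul_mod_self_right]

theorem IsTemporalWalk.reduce {s t : V} {p : List (Hop V)} (h : G.IsTemporalWalk s t p) :
    G.IsLabelledWalk s t (G.reduceHops p) := by
  induction p generalizing s with
  | nil => exact h
  | cons a p ih =>
    obtain ⟨h1, h2, h3, -⟩ := h
    exact ⟨by simpa only [edges_mod] using h1, Nat.mod_lt _ G.period_pos, h2, ih h3⟩

theorem IsTemporalWalk.pairwise {s t : V} {p : List (Hop V)} (h : G.IsTemporalWalk s t p) :
    p.Pairwise fun a b => a.2 < b.2 := by
  induction p generalizing s with
  | nil => exact List.Pairwise.nil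
  | cons a p ih =>
    obtain ⟨-, -, h3, h4⟩ := h
    refine List.pairwise_cons.2 ⟨fun b hb => ?_, ih h3⟩
    cases p with
    | nil => simp at hb
    | cons c p =>
      have hc := (h4 c (by simp)).1
      rcases List.mem_cons.1 hb with rfl | hb
      · exact hc
      · exact hc.trans ((List.pairwise_cons.1 (ih h3)).1 b hb)

theorem IsTemporalWalk.nodup {s t : V} {p : List (Hop V)} (h : G.IsTemporalWalk s t p) :
    p.Nodup :=
  h.pairwise.imp fun hab h => by simp [h] at hab

/-- Makes the concatenation of two scheduled legs a schedule again, so that the whole route,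
including the joint at the intermediate node, is a legal temporal walk. -/
theorem schedule_append (τ : ℕ) (p q : List (Hop V)) :
    G.schedule τ (p ++ q) = G.schedule τ p ++ G.schedule (G.scheduleEnd τ p) q := by
  induction p generalizing τ with
  | nil => rfl
  | cons a p ih => simp only [List.cons_append, schedule, scheduleEnd, ih]

theorem length_schedule (τ : ℕ) (p : List (Hop V)) : (G.schedule τ p).length = p.length := by
  induction p generalizing τ with
  | nil => rfl
  | cons a p ih => simp only [schedule, List.length_cons, ih]

theorem map_target_schedule (τ : ℕ) (p : List (Hop V)) :
    (G.schedule τ p).map (fun h => h.1.2) = p.map fun h => h.1.2 := by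
  induction p generalizing τ with
  | nil => rfl
  | cons a p ih => simp only [schedule, List.map_cons, ih]

theorem IsLabelledWalk.reduceHops_schedule {s t : V} {p : List (Hop V)}
    (h : G.IsLabelledWalk s t p) (τ : ℕ) : G.reduceHops (G.schedule τ p) = p := by
  induction p generalizing s τ with
  | nil => rfl
  | cons a p ih =>
    obtain ⟨-, h2, -, h4⟩ := h
    have := ih h4 (G.nextSlot τ a.2 + 1)
    simp only [reduceHops] at this
    simp only [schedule, reduceHops, List.map_cons, this, nextSlot_mod, Nat.mod_eq_of_lt h2]

/-- Any `G.period` consecutive timeslots contain every residue, so the next edge is available after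
a wait of between one slot and one period. -/
theorem IsLabelledWalk.isTemporalWalk_schedule {s t : V} {p : List (Hop V)}
    (h : G.IsLabelledWalk s t p) (τ : ℕ) : G.IsTemporalWalk s t (G.schedule τ p) := by
  induction p generalizing s τ with
  | nil => exact h
  | cons a p ih =>
    obtain ⟨h1, h2, h3, h4⟩ := h
    refine ⟨?_, h3, ih h4 _, ?_⟩
    · rw [← edges_mod, nextSlot_mod, edges_mod]
      exact h1
    · cases p with
      | nil => simp [schedule]
      | cons b p =>
        simp only [schedule, List.head?_cons, Option.mem_def, Option.some.injEq, forall_eq']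
        have h5 := le_nextSlot (G := G) (G.nextSlot τ a.2 + 1) b.2
        have h6 := nextSlot_lt (G := G) (G.nextSlot τ a.2 + 1) b.2
        omega

theorem head_schedule_zero (p : List (Hop V)) : ∀ h ∈ (G.schedule 0 p).head?, h.2 < G.period := by
  cases p with
  | nil => simp [schedule]
  | cons a p =>
    simp only [schedule, List.head?_cons, Option.mem_def, Option.some.injEq, forall_eq']
    simpa using nextSlot_lt (G := G) 0 a.2

theorem IsLabelledWalk.append {s t u : V} {p q : List (Hop V)} (hp : G.IsLabelledWalk s t p)
    (hq : G.IsLabelledWalk t u q) : G.IsLabelledWalk s u (p ++ q) := by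
  induction p generalizing s with
  | nil => cases hp; exact hq
  | cons a p ih => exact ⟨hp.1, hp.2.1, hp.2.2.1, ih hp.2.2.2⟩

theorem IsLabelledWalk.flatten_replicate {s : V} {p : List (Hop V)} (hp : G.IsLabelledWalk s s p)
    (k : ℕ) : G.IsLabelledWalk s s (List.replicate k p).flatten := by
  induction k with
  | zero => rfl
  | succ k ih =>
    rw [List.replicate_succ, List.flatten_cons]
    exact hp.append ih

theorem IsLabelledWalk.edge_of_mem {s t : V} {p : List (Hop V)}
    (hp : G.IsLabelledWalk s t p) {h : Hop V} (hh : h ∈ p) :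
    h.1 ∈ G.edges h.2 ∧ h.2 < G.period := by
  induction p generalizing s with
  | nil => simp at hh
  | cons a p ih =>
    rcases List.mem_cons.1 hh with rfl | hh
    · exact ⟨hp.1, hp.2.1⟩
    · exact ih hp.2.2.2 hh

theorem IsLabelledWalk.exists_suffix {s t v : V} {p : List (Hop V)} (hp : G.IsLabelledWalk s t p)
    (hv : v ∈ s :: p.map fun h => h.1.2) :
    ∃ q, q <:+ p ∧ G.IsLabelledWalk v t q ∧
      (v :: q.map fun h => h.1.2) <:+ (s :: p.map fun h => h.1.2) := by
  induction p generalizing s with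
  | nil =>
    obtain rfl : v = s := by simpa using hv
    exact ⟨[], List.suffix_rfl, hp, List.suffix_rfl⟩
  | cons a p ih =>
    rcases List.mem_cons.1 hv with rfl | hv
    · exact ⟨a :: p, List.suffix_rfl, hp, List.suffix_rfl⟩
    · obtain ⟨q, h1, h2, h3⟩ := ih hp.2.2.2 hv
      exact ⟨q, h1.trans (List.suffix_cons _ _), h2, h3.trans (List.suffix_cons _ _)⟩

/-- Every walk contains a walk with the same ends that visits no vertex twice. -/
theorem IsLabelledWalk.exists_simple {s t : V} {p : List (Hop V)} (hp : G.IsLabelledWalk s t p) :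
    ∃ q, q.Sublist p ∧ G.IsLabelledWalk s t q ∧ (s :: q.map fun h => h.1.2).Nodup := by
  induction p generalizing s with
  | nil => exact ⟨[], List.Sublist.refl _, hp, by simp⟩
  | cons a p ih =>
    obtain ⟨h1, h2, h3, h4⟩ := hp
    obtain ⟨q, hq1, hq2, hq3⟩ := ih h4
    -- If the shortened tail returns to `s`, everything before that return is cut off; otherwise the
    -- first edge can be kept.
    by_cases hs : s ∈ a.1.2 :: q.map fun h => h.1.2
    · obtain ⟨q', h5, h6, h7⟩ := hq2.exists_suffix hs
      exact ⟨q', (h5.sublist.trans hq1).trans (List.sublist_cons_self _ _), h6,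
        hq3.sublist h7.sublist⟩
    · exact ⟨a :: q, hq1.cons_cons a, ⟨h1, h2, h3, hq2⟩, List.nodup_cons.2 ⟨hs, hq3⟩⟩

theorem IsLabelledWalk.emulatedWalk {s t : V} {p : List (Hop V)}
    (h : G.IsLabelledWalk s t p) : G.EmulatedWalk p.length s t := by
  induction p generalizing s with
  | nil => exact h
  | cons a p ih =>
    obtain ⟨h1, h2, rfl, h4⟩ := h
    exact ⟨a.1.2, ⟨a.2, h2, h1⟩, ih h4⟩

/-- A walk leaves a vertex as often as it enters it, up to the ends. -/
theorem IsLabelledWalk.countP_source_add [DecidableEq V] {s t : V} {p : List (Hop V)}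
    (hp : G.IsLabelledWalk s t p) (v : V) :
    p.countP (fun h => h.1.1 = v) + (if t = v then 1 else 0) =
      p.countP (fun h => h.1.2 = v) + (if s = v then 1 else 0) := by
  induction p generalizing s with
  | nil => cases hp; rfl
  | cons a p ih =>
    obtain ⟨-, -, rfl, h4⟩ := hp
    have := ih h4
    simp only [List.countP_cons, decide_eq_true_eq]
    omega

end PeriodicEvolvingGraph

/-! ### Links of a Mars network and regularity -/

/-- All sequences of `m` links. -/
def linkWords (nu Γ : ℕ) : ℕ → Finset (List (Fin nu × Fin Γ))
  | 0 => {[]}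
  | m + 1 => (Finset.univ ×ˢ linkWords nu Γ m).map
      ⟨fun x : (Fin nu × Fin Γ) × List (Fin nu × Fin Γ) => x.1 :: x.2, fun x y h => by
        simp only [List.cons.injEq] at h
        exact Prod.ext h.1 h.2⟩

theorem sum_linkWords_succ {nu Γ : ℕ} {β : Type*} [AddCommMonoid β] (m : ℕ)
    (f : List (Fin nu × Fin Γ) → β) :
    ∑ w ∈ linkWords nu Γ (m + 1), f w = ∑ a, ∑ w ∈ linkWords nu Γ m, f (a :: w) := by
  rw [linkWords, Finset.sum_map, Finset.sum_product]
  rfl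

theorem mem_linkWords {nu Γ m : ℕ} {w : List (Fin nu × Fin Γ)} :
    w ∈ linkWords nu Γ m ↔ w.length = m := by
  induction m generalizing w with
  | zero => simp [linkWords]
  | succ m ih =>
    cases w with
    | nil => simp [linkWords]
    | cons a w =>
      rw [linkWords, Finset.mem_map, List.length_cons, Nat.add_right_cancel_iff, ← ih]
      constructor
      · rintro ⟨⟨b, v⟩, hv, h⟩
        cases h
        exact (Finset.mem_product.1 hv).2
      · exact fun hw => ⟨(a, w), Finset.mem_product.2 ⟨Finset.mem_univ _, hw⟩, rfl⟩

theorem card_linkWords (nu Γ m : ℕ) : (linkWords nu Γ m).card = (nu * Γ) ^ m := by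
  induction m with
  | zero => simp [linkWords]
  | succ m ih =>
    rw [linkWords, Finset.card_map, Finset.card_product, ih]
    simp [pow_succ, mul_comm]

/-- The possible labelled edges of the emulated graph. -/
def hopSet (V : Type*) [Fintype V] (Γ : ℕ) : Finset (Hop V) := Finset.univ ×ˢ Finset.range Γ

theorem mem_hopSet {V : Type*} [Fintype V] {Γ : ℕ} {x : Hop V} :
    x ∈ hopSet V Γ ↔ x.2 < Γ := by simp [hopSet]

theorem sum_hopSet {V : Type*} [Fintype V] {Γ : ℕ} {β : Type*} [AddCommMonoid β] (f : Hop V → β) :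
    ∑ x ∈ hopSet V Γ, f x = ∑ u, ∑ v, ∑ l : Fin Γ, f ((u, v), (l : ℕ)) := by
  rw [hopSet, Finset.sum_product, Fintype.sum_prod_type]
  simp only [Finset.sum_range fun l => f ((_, _), l)]

namespace MarsNetwork

variable {V : Type*} {nu Γ : ℕ} (N : MarsNetwork V nu Γ)

/-- The walk which leaves `s` along the given sequence of links. -/
def followLinks : V → List (Fin nu × Fin Γ) → List (Hop V)
  | _, [] => []
  | s, a :: w => ((s, N.matching a.1 a.2 s), (a.2 : ℕ)) :: followLinks (N.matching a.1 a.2 s) w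

/-- The end of the walk which leaves `s` along the given sequence of links. -/
def linksEnd : V → List (Fin nu × Fin Γ) → V
  | s, [] => s
  | s, a :: w => linksEnd (N.matching a.1 a.2 s) w

variable {N}

theorem length_followLinks (s : V) (w : List (Fin nu × Fin Γ)) :
    (N.followLinks s w).length = w.length := by
  induction w generalizing s with
  | nil => rfl
  | cons a w ih => simp only [followLinks, List.length_cons, ih]

variable [DecidableEq V] [NeZero Γ] (N)

/-- Number of parallel links along the edge of a hop in its timeslot. -/
def linkCount (x : Hop V) : ℕ :=
  (Finset.univ.filter fun i => N.matching i (Fin.ofNat Γ x.2) x.1.1 = x.1.2).card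

variable {N}

theorem period_graph : N.graph.period = Γ := rfl

theorem cap_graph (e : V × V) (t : ℕ) : N.graph.cap t e = N.linkCap * N.linkCount (e, t) := rfl

theorem ofNat_val (l : Fin Γ) : Fin.ofNat Γ (l : ℕ) = l := by ext; simp

theorem linkCount_val (u v : V) (l : Fin Γ) :
    N.linkCount ((u, v), (l : ℕ)) = ∑ i, if N.matching i l u = v then 1 else 0 := by
  rw [linkCount, Finset.card_filter]
  simp only [ofNat_val]

theorem linkCount_mod (e : V × V) (t : ℕ) : N.linkCount (e, t % Γ) = N.linkCount (e, t) := by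
  have : Fin.ofNat Γ (t % Γ) = Fin.ofNat Γ t := by ext; simp
  simp only [linkCount, this]

theorem linkCount_pos {x : Hop V} : 0 < N.linkCount x ↔ x.1 ∈ N.graph.edges x.2 := by
  rw [linkCount, Finset.card_pos, Finset.filter_nonempty_iff]
  simp [graph]

theorem sum_linkCount_source [Fintype V] (v : V) :
    ∑ x ∈ hopSet V Γ with x.1.1 = v, N.linkCount x = nu * Γ := by
  rw [Finset.sum_filter, sum_hopSet]
  simp only [linkCount_val]
  rw [Finset.sum_eq_single v (fun u _ hu => by simp [hu]) (by simp)]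
  simp only [if_true]
  rw [Finset.sum_comm]
  simp only [Finset.sum_comm (s := (Finset.univ : Finset V)), Finset.sum_ite_eq]
  simp [mul_comm]

/-- Here bijectivity of the matchings enters: each of them has exactly one edge into `v`. -/
theorem sum_linkCount_target [Fintype V] (v : V) :
    ∑ x ∈ hopSet V Γ with x.1.2 = v, N.linkCount x = nu * Γ := by
  rw [Finset.sum_filter, sum_hopSet, Finset.sum_comm]
  simp only [linkCount_val]
  rw [Finset.sum_eq_single v (fun u _ hu => by simp [hu]) (by simp)]
  simp only [if_true]
  rw [Finset.sum_comm]
  simp only [Finset.sum_comm (s := (Finset.univ : Finset V)), ← Equiv.eq_symm_apply,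
    Finset.sum_ite_eq']
  simp [mul_comm]

theorem sum_linkCount [Fintype V] :
    ∑ x ∈ hopSet V Γ, N.linkCount x = Fintype.card V * (nu * Γ) := by
  rw [← Finset.sum_fiberwise (hopSet V Γ) (fun x => x.1.1)]
  simp [sum_linkCount_source]

/-- The value does not depend on `u`, so all row sums of a saturated matrix agree;
`inCapacity_graph` does the same for columns. -/
theorem outCapacity_graph [Fintype V] (u : V) :
    N.graph.outCapacity u = N.graph.slotShare * N.linkCap * (nu * Γ : ℕ) := by
  rw [← sum_linkCount_source (N := N) u, Finset.sum_filter, sum_hopSet,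
    Finset.sum_eq_single u (fun v _ hv => by simp [hv]) (by simp)]
  simp only [if_true, PeriodicEvolvingGraph.outCapacity, PeriodicEvolvingGraph.emulatedCap,
    cap_graph, period_graph, Finset.sum_range, Nat.cast_sum, Finset.mul_sum, mul_assoc]
  exact Finset.sum_comm

theorem inCapacity_graph [Fintype V] (u : V) :
    N.graph.inCapacity u = N.graph.slotShare * N.linkCap * (nu * Γ : ℕ) := by
  rw [← sum_linkCount_target (N := N) u, Finset.sum_filter, sum_hopSet, Finset.sum_comm,
    Finset.sum_eq_single u (fun v _ hv => by simp [hv]) (by simp)]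
  simp only [if_true, PeriodicEvolvingGraph.inCapacity, PeriodicEvolvingGraph.emulatedCap,
    cap_graph, period_graph, Finset.sum_range, Nat.cast_sum, Finset.mul_sum, mul_assoc]
  exact Finset.sum_comm

theorem slotShare_pos : 0 < N.graph.slotShare :=
  div_pos (sub_pos.2 N.latencyTax_lt_one) (Nat.cast_pos.2 N.graph.period_pos)

theorem isLabelledWalk_followLinks (s : V) (w : List (Fin nu × Fin Γ)) :
    N.graph.IsLabelledWalk s (N.linksEnd s w) (N.followLinks s w) := by
  induction w generalizing s with
  | nil => rfl
  | cons a w ih =>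
    exact ⟨⟨a.1, by simp only [ofNat_val]⟩, a.2.2, rfl, ih _⟩

theorem exists_linksEnd_eq_of_emulatedWalk {k : ℕ} {s t : V} (h : N.graph.EmulatedWalk k s t) :
    ∃ w ∈ linkWords nu Γ k, N.linksEnd s w = t := by
  induction k generalizing s with
  | zero => exact ⟨[], by simp [linkWords], h⟩
  | succ k ih =>
    obtain ⟨u, ⟨l, hl, i, hi⟩, hu⟩ := h
    obtain ⟨w, hw, rfl⟩ := ih hu
    refine ⟨(i, Fin.ofNat Γ l) :: w, by simpa [mem_linkWords] using hw, ?_⟩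
    simp only at hi
    simp only [linksEnd, hi]

/-- By regularity, every link is used equally often by all walks of a given length. -/
theorem sum_count_followLinks [Fintype V] (m : ℕ) {x : Hop V} (hx : x.2 < Γ) :
    ∑ s, ∑ w ∈ linkWords nu Γ m, (N.followLinks s w).count x =
      m * (nu * Γ) ^ (m - 1) * N.linkCount x := by
  induction m with
  | zero => simp [linkWords, followLinks]
  | succ m ih =>
    obtain ⟨⟨u, v⟩, l⟩ := x
    -- The first link permutes the starting points, so the remaining walks are again counted from
    -- every vertex once.
    have h1 (a : Fin nu × Fin Γ) (w : List (Fin nu × Fin Γ)) :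
        ∑ s, (N.followLinks (N.matching a.1 a.2 s) w).count ((u, v), l) =
          ∑ s, (N.followLinks s w).count ((u, v), l) :=
      Equiv.sum_comp (N.matching a.1 a.2) fun s => (N.followLinks s w).count ((u, v), l)
    have h2 : ∑ s : V, ∑ a : Fin nu × Fin Γ,
        (if ((s, N.matching a.1 a.2 s), (a.2 : ℕ)) = ((u, v), l) then 1 else 0) =
        N.linkCount ((u, v), l) := by
      rw [Finset.sum_eq_single u (fun s _ hs => by simp [hs]) (by simp), Fintype.sum_prod_type]
      lift l to Fin Γ using hx
      rw [linkCount_val]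
      refine Finset.sum_congr rfl fun i _ => ?_
      rw [Finset.sum_eq_single l (fun k _ hk => by simp [Fin.val_inj, hk]) (by simp)]
      simp
    simp only [sum_linkWords_succ, followLinks, List.count_cons, beq_iff_eq, Finset.sum_add_distrib,
      Finset.sum_const, card_linkWords, smul_eq_mul, ← Finset.mul_sum, h2]
    rw [Finset.sum_comm]
    simp only [Finset.sum_comm (s := (Finset.univ : Finset V)) (t := linkWords nu Γ m), h1]
    rw [Finset.sum_comm] at ih
    simp only [ih, Finset.sum_const, Finset.card_univ, Fintype.card_prod, Fintype.card_fin,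
      smul_eq_mul, Nat.add_sub_cancel]
    cases m with
    | zero => simp
    | succ m => rw [Nat.add_sub_cancel]; ring

end MarsNetwork

/-! ### Loads in the evolving graph and in the emulated graph -/

namespace RouteFlow

variable {V : Type*}

/-- Sum of a function of the routes of a flow, weighted with the flow. -/
def routeSum (φ : VLBRoute V → ℝ) (F : RouteFlow V) : ℝ := ∑ r ∈ F.support, F r * φ r

/-- By linearity in the flow, the routes `r i` need not be distinct. -/
theorem routeSum_sum_single {ι : Type*} (φ : VLBRoute V → ℝ) (I : Finset ι) (r : ι → VLBRoute V)
    (a : ι → ℝ) :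
    routeSum φ (∑ i ∈ I, Finsupp.single (r i) (a i)) = ∑ i ∈ I, a i * φ (r i) := by
  have h (F : RouteFlow V) : routeSum φ F = Finsupp.linearCombination ℝ φ F := by
    simp [routeSum, Finsupp.linearCombination_apply, Finsupp.sum]
  rw [h, map_sum]
  simp [Finsupp.linearCombination_single]

theorem mem_delayHops_cons {τ : ℕ} {x h : Hop V} {p : List (Hop V)} :
    x ∈ delayHops τ (h :: p) ↔ (h.1, h.2 + τ) = x ∨ x ∈ delayHops τ p := by
  simp only [delayHops, List.map_cons, List.mem_cons, eq_comm]

theorem routeSum_mono {F : RouteFlow V} (hF : ∀ r, 0 ≤ F r) {φ ψ : VLBRoute V → ℝ}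
    (h : ∀ r ∈ F.support, φ r ≤ ψ r) : routeSum φ F ≤ routeSum ψ F :=
  Finset.sum_le_sum fun r hr => mul_le_mul_of_nonneg_left (h r hr) (hF r)

theorem pairFlow_eq_routeSum [DecidableEq V] (F : RouteFlow V) (s t : V) :
    F.pairFlow s t = routeSum (fun r => if r.src = s ∧ r.dst = t then 1 else 0) F := by
  classical
  simp only [pairFlow, routeSum, mul_ite, mul_one, mul_zero, Finset.sum_filter]
  congr!

theorem viaFlow_eq_routeSum [DecidableEq V] (F : RouteFlow V) (s w t : V) :
    F.viaFlow s w t =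
      routeSum (fun r => if r.src = s ∧ r.mid = w ∧ r.dst = t then 1 else 0) F := by
  classical
  simp only [viaFlow, routeSum, mul_ite, mul_one, mul_zero, Finset.sum_filter]
  congr!

/-- Flow on a labelled edge of the emulated graph, summed over all routes of the first period. -/
def emulatedLoad [DecidableEq V] (G : PeriodicEvolvingGraph V) (F : RouteFlow V) (x : Hop V) : ℝ :=
  routeSum (fun r => ((G.reduceHops r.hops).count x : ℝ)) F

variable [DecidableEq V] {G : PeriodicEvolvingGraph V}

/-- At most one periodic copy of a hop takes place at time `t`, and only if the residues agree. -/
theorem sum_delay_eq_le (h : Hop V) (e : V × V) (t : ℕ) :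
    (∑ k ∈ Finset.range (t + 1), if (h.1, h.2 + k * G.period) = (e, t) then 1 else 0) ≤
      if (h.1, h.2 % G.period) = (e, t % G.period) then 1 else 0 := by
  rw [← Finset.card_filter]
  split_ifs with hx
  · refine Finset.card_le_one.2 fun a ha b hb => ?_
    simp only [Finset.mem_filter, Prod.mk.injEq] at ha hb
    exact Nat.eq_of_mul_eq_mul_right G.period_pos (by omega)
  · refine (Finset.card_eq_zero.2 (Finset.filter_eq_empty_iff.2 fun k _ hk => hx ?_)).le
    simp only [Prod.mk.injEq] at hk ⊢
    exact ⟨hk.1, by rw [← hk.2, Nat.add_mul_mod_self_right]⟩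

theorem le_sum_delay_eq (h : Hop V) (e : V × V) {t : ℕ} (ht : h.2 ≤ t) :
    (if (h.1, h.2 % G.period) = (e, t % G.period) then 1 else 0) ≤
    ∑ k ∈ Finset.range (t + 1), if (h.1, h.2 + k * G.period) = (e, t) then 1 else 0 := by
  split_ifs with hx
  · simp only [Prod.mk.injEq] at hx
    obtain ⟨k, hk⟩ : G.period ∣ t - h.2 := (Nat.modEq_iff_dvd' ht).1 hx.2
    have hk' : h.2 + k * G.period = t := by rw [mul_comm, ← hk]; omega
    rw [← Finset.card_filter]
    refine Finset.card_pos.2 ⟨k, Finset.mem_filter.2 ⟨Finset.mem_range.2 ?_, ?_⟩⟩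
    · have := Nat.le_mul_of_pos_right k G.period_pos
      omega
    · rw [hx.1, hk']
  · exact Nat.zero_le _

open Classical in
theorem sum_mem_delayHops_le (p : List (Hop V)) (e : V × V) (t : ℕ) :
    (∑ k ∈ Finset.range (t + 1), if (e, t) ∈ delayHops (k * G.period) p then 1 else 0) ≤
      (G.reduceHops p).count (e, t % G.period) := by
  induction p with
  | nil => simp [delayHops]
  | cons h p ih =>
    have := sum_delay_eq_le (G := G) h e t
    simp only [PeriodicEvolvingGraph.reduceHops, List.map_cons, List.count_cons, beq_iff_eq]
      at ih ⊢
    refine le_trans ?_ (add_le_add ih this)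
    rw [← Finset.sum_add_distrib]
    refine Finset.sum_le_sum fun k _ => ?_
    simp only [mem_delayHops_cons]
    split_ifs <;> simp_all

open Classical in
-- The left side counts hops, the right side counts copies of the route. As no hop is repeated,
-- different hops meet `(e, t)` in different copies; `ht` ensures that the required delays are not
-- negative.
theorem le_sum_mem_delayHops {p : List (Hop V)} (hp : p.Nodup) (e : V × V) {t : ℕ}
    (ht : ∀ h ∈ p, h.2 ≤ t) :
    (G.reduceHops p).count (e, t % G.period) ≤
    ∑ k ∈ Finset.range (t + 1), if (e, t) ∈ delayHops (k * G.period) p then 1 else 0 := by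
  induction p with
  | nil => simp [PeriodicEvolvingGraph.reduceHops]
  | cons h p ih =>
    obtain ⟨h1, h2⟩ := List.nodup_cons.1 hp
    have h3 := le_sum_delay_eq (G := G) h e (ht h (by simp))
    have h4 := ih h2 fun a ha => ht a (by simp [ha])
    simp only [PeriodicEvolvingGraph.reduceHops, List.map_cons, List.count_cons, beq_iff_eq]
      at h4 ⊢
    refine le_trans (add_le_add h4 h3) ?_
    rw [← Finset.sum_add_distrib]
    refine Finset.sum_le_sum fun k _ => ?_
    simp only [mem_delayHops_cons]
    have h5 : ¬ ((e, t) ∈ delayHops (k * G.period) p ∧ (h.1, h.2 + k * G.period) = (e, t)) := by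
      rintro ⟨h6, h7⟩
      rw [← h7] at h6
      obtain ⟨a, ha, hb⟩ := List.mem_map.1 h6
      simp only [Prod.mk.injEq, Nat.add_right_cancel_iff] at hb
      exact h1 (Prod.ext hb.1 hb.2 ▸ ha)
    split_ifs <;> simp_all

theorem load_eq_routeSum (F : RouteFlow V) (e : V × V) (t : ℕ) :
    open Classical in
    F.load G e t = routeSum (fun r => ((∑ k ∈ Finset.range (t + 1),
      if (e, t) ∈ delayHops (k * G.period) r.hops then 1 else 0 : ℕ) : ℝ)) F := by
  classical
  simp only [load, routeSum, Nat.cast_sum, Finset.mul_sum]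
  refine Finset.sum_congr rfl fun r _ => Finset.sum_congr rfl fun k _ => ?_
  split_ifs <;> simp

theorem load_le_emulatedLoad {F : RouteFlow V} (hF : ∀ r, 0 ≤ F r) (e : V × V) (t : ℕ) :
    F.load G e t ≤ F.emulatedLoad G (e, t % G.period) := by
  rw [load_eq_routeSum]
  exact routeSum_mono hF fun r _ => Nat.cast_le.2 (sum_mem_delayHops_le _ _ _)

/-- When all routes of the first period have come to their end, the load has become periodic. -/
theorem exists_emulatedLoad_le_load [Fintype V] {F : RouteFlow V} (hF : IsVLBFlow G F)
    (x : Hop V) (hx : x.2 < G.period) :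
    ∃ k, F.emulatedLoad G x ≤ F.load G x.1 (x.2 + k * G.period) := by
  obtain ⟨B, hB⟩ : ∃ B, ∀ r ∈ F.support, ∀ h ∈ r.hops, h.2 ≤ B := by
    refine ⟨∑ r ∈ F.support, (r.hops.map Prod.snd).sum, fun r hr h hh => ?_⟩
    exact (List.le_sum_of_mem (List.mem_map_of_mem hh)).trans
      (Finset.single_le_sum (f := fun r : VLBRoute V => (r.hops.map Prod.snd).sum)
        (fun _ _ => Nat.zero_le _) hr)
  -- As the period is at least 1, the time `x.2 + B * G.period` is no earlier than any hop of the
  -- first-period routes.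
  refine ⟨B, ?_⟩
  rw [load_eq_routeSum]
  refine routeSum_mono hF.nonneg fun r hr => Nat.cast_le.2 ?_
  have h := le_sum_mem_delayHops (G := G) (hF.legal r hr).2.2.1.nodup x.1
    (t := x.2 + B * G.period) fun h hh => (hB r hr h hh).trans
      ((Nat.le_mul_of_pos_right B G.period_pos).trans (Nat.le_add_left _ _))
  rwa [Nat.add_mul_mod_self_right, Nat.mod_eq_of_lt hx] at h

theorem routeSum_eq_sum_pairs [Fintype V] (F : RouteFlow V) (φ : VLBRoute V → ℝ) :
    F.routeSum φ = ∑ s, ∑ t, ∑ r ∈ F.support with r.src = s ∧ r.dst = t, F r * φ r := by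
  rw [routeSum, ← Finset.sum_fiberwise F.support fun r => (r.src, r.dst), Fintype.sum_prod_type]
  simp only [Prod.mk.injEq]

/-- The average route length of a flow that serves a multiple of the demand exactly. -/
theorem averageRouteLength_eq [Fintype V] {F : RouteFlow V} (hF : ∀ r, 0 ≤ F r)
    {M : V → V → ℝ} {c : ℝ} (hc : c ≠ 0) (h : ∀ s t, F.pairFlow s t = c * M s t) :
    F.averageRouteLength M =
      (c * ∑ a, ∑ b, M a b)⁻¹ * routeSum (fun r => (r.length : ℝ)) F := by
  classical
  rw [routeSum_eq_sum_pairs, Finset.mul_sum, averageRouteLength]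
  refine Finset.sum_congr rfl fun s _ => ?_
  rw [Finset.mul_sum]
  refine Finset.sum_congr rfl fun t _ => ?_
  rw [Finset.mul_sum]
  refine Finset.sum_congr (by congr!) fun r hr => ?_
  -- Without demand the pair has no flow, and by nonnegativity each of its routes carries none, so
  -- both sides vanish.
  rcases eq_or_ne (M s t) 0 with hM | hM
  · have h2 : F.pairFlow s t = 0 := by rw [h, hM, mul_zero]
    have h3 : F r = 0 := by
      refine (Finset.sum_eq_zero_iff_of_nonneg fun r _ => hF r).1 h2 r ?_
      convert hr
    simp [h3, hM]
  · rw [h]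
    field_simp

end RouteFlow

/-! ### Routing schemes and the flows they induce -/

/-- A routing scheme: for every pair of vertices a probability distribution on walks between them,
supported in the finite set `S`. -/
structure IsRoutingScheme {V : Type*} (G : PeriodicEvolvingGraph V) (S : Finset (List (Hop V)))
    (P : V → V → List (Hop V) → ℝ) : Prop where
  nonneg : ∀ s t p, 0 ≤ P s t p
  legal : ∀ s t p, P s t p ≠ 0 → p ∈ S ∧ G.IsLabelledWalk s t p
  total : ∀ s t, ∑ p ∈ S, P s t p = 1

/-- Sum of a function of walks over all pairs of vertices, averaged over the walks of each pair. -/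
def schemeSum {V : Type*} [Fintype V] (S : Finset (List (Hop V))) (P : V → V → List (Hop V) → ℝ)
    (φ : List (Hop V) → ℝ) : ℝ :=
  ∑ s, ∑ t, ∑ p ∈ S, P s t p * φ p

theorem schemeSum_congr {V : Type*} [Fintype V] {S : Finset (List (Hop V))}
    {P : V → V → List (Hop V) → ℝ} {φ ψ : List (Hop V) → ℝ}
    (h : ∀ s t p, P s t p ≠ 0 → φ p = ψ p) : schemeSum S P φ = schemeSum S P ψ := by
  refine Finset.sum_congr rfl fun s _ => Finset.sum_congr rfl fun t _ =>
    Finset.sum_congr rfl fun p _ => ?_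
  by_cases hp : P s t p = 0
  · simp [hp]
  · rw [h s t p hp]

theorem schemeSum_sum {V : Type*} [Fintype V] {S : Finset (List (Hop V))}
    {P : V → V → List (Hop V) → ℝ} {ι : Type*} (I : Finset ι) (φ : ι → List (Hop V) → ℝ) :
    schemeSum S P (fun p => ∑ i ∈ I, φ i p) = ∑ i ∈ I, schemeSum S P (φ i) := by
  simp only [schemeSum, Finset.mul_sum]
  rw [eq_comm, Finset.sum_comm]
  refine Finset.sum_congr rfl fun s _ => ?_
  rw [Finset.sum_comm]
  exact Finset.sum_congr rfl fun t _ => Finset.sum_comm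

/-- The route composed of two walks of the emulated graph, as early as possible. -/
def scheduledRoute {V : Type*} (G : PeriodicEvolvingGraph V)
    (i : V × V × V × List (Hop V) × List (Hop V)) : VLBRoute V where
  src := i.1
  mid := i.2.1
  dst := i.2.2.1
  first := G.schedule 0 i.2.2.2.1
  second := G.schedule (G.scheduleEnd 0 i.2.2.2.1) i.2.2.2.2

/-- The flow that sends the amount `K s t` from `s` to `t` via every intermediate node, both legs
being distributed according to a routing scheme. -/
noncomputable def schemeFlow {V : Type*} [Fintype V] (G : PeriodicEvolvingGraph V)
    (S : Finset (List (Hop V))) (P : V → V → List (Hop V) → ℝ) (K : V → V → ℝ) : RouteFlow V :=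
  ∑ i ∈ (Finset.univ ×ˢ Finset.univ ×ˢ Finset.univ ×ˢ S ×ˢ S :
      Finset (V × V × V × List (Hop V) × List (Hop V))),
    Finsupp.single (scheduledRoute G i)
      (K i.1 i.2.2.1 * P i.1 i.2.1 i.2.2.2.1 * P i.2.1 i.2.2.1 i.2.2.2.2)

namespace IsRoutingScheme

variable {V : Type*} {G : PeriodicEvolvingGraph V} {S : Finset (List (Hop V))}
  {P : V → V → List (Hop V) → ℝ}

theorem isFoundation_scheduledRoute (hP : IsRoutingScheme G S P) {s w t : V} {p q : List (Hop V)}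
    (hp : P s w p ≠ 0) (hq : P w t q ≠ 0) :
    (scheduledRoute G (s, w, t, p, q)).IsFoundation G := by
  have h1 := (hP.legal s w p hp).2
  have h2 := (hP.legal w t q hq).2
  refine ⟨h1.isTemporalWalk_schedule 0, h2.isTemporalWalk_schedule _, ?_, ?_⟩
  · simp only [VLBRoute.hops, scheduledRoute, ← PeriodicEvolvingGraph.schedule_append]
    exact (h1.append h2).isTemporalWalk_schedule 0
  · simp only [VLBRoute.hops, scheduledRoute, ← PeriodicEvolvingGraph.schedule_append]
    exact PeriodicEvolvingGraph.head_schedule_zero _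

theorem sum_mul_mul (hP : IsRoutingScheme G S P) (a : ℝ) (s w t : V) :
    ∑ p ∈ S, ∑ q ∈ S, a * P s w p * P w t q = a := by
  simp only [← Finset.mul_sum, hP.total, mul_one]

variable [Fintype V]

theorem routeSum_schemeFlow (K : V → V → ℝ) (φ : VLBRoute V → ℝ) :
    (schemeFlow G S P K).routeSum φ = ∑ s, ∑ w, ∑ t, ∑ p ∈ S, ∑ q ∈ S,
      K s t * P s w p * P w t q * φ (scheduledRoute G (s, w, t, p, q)) := by
  rw [schemeFlow, RouteFlow.routeSum_sum_single]
  simp only [Finset.sum_product]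

theorem exists_of_mem_support {K : V → V → ℝ} {r : VLBRoute V}
    (hr : r ∈ (schemeFlow G S P K).support) :
    ∃ s w t p q, P s w p ≠ 0 ∧ P w t q ≠ 0 ∧ r = scheduledRoute G (s, w, t, p, q) := by
  classical
  rw [Finsupp.mem_support_iff, schemeFlow, Finsupp.finsetSum_apply] at hr
  obtain ⟨⟨s, w, t, p, q⟩, -, h⟩ := Finset.exists_ne_zero_of_sum_ne_zero hr
  rw [Finsupp.single_apply] at h
  split_ifs at h with hi
  · exact ⟨s, w, t, p, q, right_ne_zero_of_mul (left_ne_zero_of_mul h), right_ne_zero_of_mul h,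
      hi.symm⟩
  · exact absurd rfl h

theorem schemeFlow_nonneg (hP : IsRoutingScheme G S P) {K : V → V → ℝ} (hK : ∀ s t, 0 ≤ K s t)
    (r : VLBRoute V) : 0 ≤ schemeFlow G S P K r := by
  classical
  rw [schemeFlow, Finsupp.finsetSum_apply]
  refine Finset.sum_nonneg fun i _ => ?_
  rw [Finsupp.single_apply]
  split_ifs
  · exact mul_nonneg (mul_nonneg (hK _ _) (hP.nonneg _ _ _)) (hP.nonneg _ _ _)
  · exact le_rfl

theorem viaFlow_schemeFlow (hP : IsRoutingScheme G S P) (K : V → V → ℝ) (s w t : V) :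
    (schemeFlow G S P K).viaFlow s w t = K s t := by
  classical
  rw [RouteFlow.viaFlow_eq_routeSum, routeSum_schemeFlow,
    Finset.sum_eq_single s (fun _ _ h => by simp [scheduledRoute, h]) (by simp),
    Finset.sum_eq_single w (fun _ _ h => by simp [scheduledRoute, h]) (by simp),
    Finset.sum_eq_single t (fun _ _ h => by simp [scheduledRoute, h]) (by simp)]
  simp [scheduledRoute, hP.sum_mul_mul]

theorem pairFlow_schemeFlow (hP : IsRoutingScheme G S P) (K : V → V → ℝ) (s t : V) :
    (schemeFlow G S P K).pairFlow s t = Fintype.card V * K s t := by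
  classical
  rw [RouteFlow.pairFlow_eq_routeSum, routeSum_schemeFlow,
    Finset.sum_eq_single s (fun _ _ h => by simp [scheduledRoute, h]) (by simp), Finset.sum_comm,
    Finset.sum_eq_single t (fun _ _ h => by simp [scheduledRoute, h]) (by simp)]
  simp [scheduledRoute, hP.sum_mul_mul]

/-- Under balanced demands both legs together are distributed like twice the uniform demand. -/
theorem sum_legs (hP : IsRoutingScheme G S P) {K : V → V → ℝ} {κ : ℝ}
    (hrow : ∀ s, ∑ t, K s t = κ) (hcol : ∀ t, ∑ s, K s t = κ) (φ : List (Hop V) → ℝ) :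
    ∑ s, ∑ w, ∑ t, ∑ p ∈ S, ∑ q ∈ S, K s t * P s w p * P w t q * (φ p + φ q) =
      2 * κ * schemeSum S P φ := by
  have h1 (s w t : V) : ∑ p ∈ S, ∑ q ∈ S, K s t * P s w p * P w t q * (φ p + φ q) =
      K s t * ∑ p ∈ S, P s w p * φ p + K s t * ∑ q ∈ S, P w t q * φ q := by
    have h2 : ∑ p ∈ S, ∑ q ∈ S, K s t * P s w p * P w t q * (φ p + φ q) =
        K s t * ((∑ p ∈ S, P s w p * φ p) * (∑ q ∈ S, P w t q)) +
        K s t * ((∑ p ∈ S, P s w p) * ∑ q ∈ S, P w t q * φ q) := by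
      rw [Finset.sum_mul_sum, Finset.sum_mul_sum, Finset.mul_sum, Finset.mul_sum,
        ← Finset.sum_add_distrib]
      refine Finset.sum_congr rfl fun p _ => ?_
      rw [Finset.mul_sum, Finset.mul_sum, ← Finset.sum_add_distrib]
      exact Finset.sum_congr rfl fun q _ => by ring
    rw [h2, hP.total, hP.total, mul_one, one_mul]
  simp only [h1, Finset.sum_add_distrib]
  -- The first leg from `s` to `w` does not depend on `t`, so summing over `t` leaves the row sum,
  -- the same for every pair `(s, w)`. Second legs use the column sums in the same way.
  have h3 : ∑ s, ∑ w, ∑ t, K s t * ∑ p ∈ S, P s w p * φ p = κ * schemeSum S P φ := by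
    rw [schemeSum, Finset.mul_sum]
    refine Finset.sum_congr rfl fun s _ => ?_
    rw [Finset.mul_sum]
    exact Finset.sum_congr rfl fun w _ => by rw [← Finset.sum_mul, hrow]
  have h4 : ∑ s, ∑ w, ∑ t, K s t * ∑ q ∈ S, P w t q * φ q = κ * schemeSum S P φ := by
    rw [schemeSum, Finset.mul_sum, Finset.sum_comm]
    refine Finset.sum_congr rfl fun w _ => ?_
    rw [Finset.mul_sum, Finset.sum_comm]
    exact Finset.sum_congr rfl fun t _ => by rw [← Finset.sum_mul, hcol]
  rw [h3, h4]
  ring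

theorem routeSum_legs (hP : IsRoutingScheme G S P) {K : V → V → ℝ} {κ : ℝ}
    (hrow : ∀ s, ∑ t, K s t = κ) (hcol : ∀ t, ∑ s, K s t = κ) {ψ : VLBRoute V → ℝ}
    {φ : List (Hop V) → ℝ} (h : ∀ s w t p q, P s w p ≠ 0 → P w t q ≠ 0 →
      ψ (scheduledRoute G (s, w, t, p, q)) = φ p + φ q) :
    (schemeFlow G S P K).routeSum ψ = 2 * κ * schemeSum S P φ := by
  rw [← hP.sum_legs hrow hcol, routeSum_schemeFlow]
  refine Finset.sum_congr rfl fun s _ => Finset.sum_congr rfl fun w _ =>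
    Finset.sum_congr rfl fun t _ => Finset.sum_congr rfl fun p _ => Finset.sum_congr rfl fun q _ => ?_
  by_cases hp : P s w p = 0
  · simp [hp]
  by_cases hq : P w t q = 0
  · simp [hq]
  rw [h s w t p q hp hq]

theorem routeSum_length_schemeFlow (hP : IsRoutingScheme G S P) {K : V → V → ℝ} {κ : ℝ}
    (hrow : ∀ s, ∑ t, K s t = κ) (hcol : ∀ t, ∑ s, K s t = κ) :
    (schemeFlow G S P K).routeSum (fun r => (r.length : ℝ)) =
      2 * κ * schemeSum S P fun p => (p.length : ℝ) :=
  hP.routeSum_legs hrow hcol fun s w t p q _ _ => by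
    simp [VLBRoute.length, VLBRoute.hops, scheduledRoute, PeriodicEvolvingGraph.length_schedule]

theorem emulatedLoad_schemeFlow [DecidableEq V] (hP : IsRoutingScheme G S P) {K : V → V → ℝ} {κ : ℝ}
    (hrow : ∀ s, ∑ t, K s t = κ) (hcol : ∀ t, ∑ s, K s t = κ) (x : Hop V) :
    (schemeFlow G S P K).emulatedLoad G x = 2 * κ * schemeSum S P fun p => (p.count x : ℝ) := by
  refine hP.routeSum_legs hrow hcol fun s w t p q hp hq => ?_
  have h := ((hP.legal s w p hp).2.append (hP.legal w t q hq).2).reduceHops_schedule 0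
  simp only [VLBRoute.hops, scheduledRoute, ← PeriodicEvolvingGraph.schedule_append, h,
    List.count_append, Nat.cast_add]

theorem hasSimpleLegs (hS : ∀ s t p, P s t p ≠ 0 → (s :: p.map fun h => h.1.2).Nodup)
    {K : V → V → ℝ} : ∀ r ∈ (schemeFlow G S P K).support, r.HasSimpleLegs := by
  intro r hr
  obtain ⟨s, w, t, p, q, hp, hq, rfl⟩ := exists_of_mem_support hr
  simp only [VLBRoute.HasSimpleLegs, scheduledRoute, PeriodicEvolvingGraph.map_target_schedule]
  exact ⟨hS _ _ _ hp, hS _ _ _ hq⟩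

theorem isVLBFlow_schemeFlow [Nonempty V] [DecidableEq V] (hP : IsRoutingScheme G S P)
    {K : V → V → ℝ} {κ : ℝ} (hK : ∀ s t, 0 ≤ K s t)
    (hrow : ∀ s, ∑ t, K s t = κ) (hcol : ∀ t, ∑ s, K s t = κ)
    (hcap : ∀ x : Hop V, x.2 < G.period →
      2 * κ * schemeSum S P (fun p => (p.count x : ℝ)) ≤ G.cap x.2 x.1) :
    IsVLBFlow G (schemeFlow G S P K) where
  nonneg := hP.schemeFlow_nonneg hK
  legal r hr := by
    obtain ⟨s, w, t, p, q, hp, hq, rfl⟩ := exists_of_mem_support hr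
    exact hP.isFoundation_scheduledRoute hp hq
  capacity e t := by
    refine (RouteFlow.load_le_emulatedLoad (hP.schemeFlow_nonneg hK) e t).trans ?_
    rw [hP.emulatedLoad_schemeFlow hrow hcol]
    refine (hcap _ (Nat.mod_lt _ G.period_pos)).trans_eq ?_
    exact congrFun (Function.Periodic.map_mod_nat (f := G.cap)
      (fun t => funext fun e => G.cap_periodic t e) t) e
  balanced s w t := by
    rw [hP.viaFlow_schemeFlow, hP.pairFlow_schemeFlow, mul_div_cancel_left₀]
    exact Nat.cast_ne_zero.2 Fintype.card_ne_zero

end IsRoutingScheme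

namespace MarsNetwork

variable {V : Type*} [Fintype V] [DecidableEq V] {nu Γ : ℕ} [NeZero Γ] {N : MarsNetwork V nu Γ}
  {S : Finset (List (Hop V))} {P : V → V → List (Hop V) → ℝ}

/-- No link carries more than `Λ` when one unit is sent between all pairs of vertices. -/
def LoadLE (N : MarsNetwork V nu Γ) (S : Finset (List (Hop V)))
    (P : V → V → List (Hop V) → ℝ) (Λ : ℝ) : Prop :=
  ∀ x : Hop V, x.2 < Γ → schemeSum S P (fun p => (p.count x : ℝ)) ≤ Λ * N.linkCount x

/-- A scheme of load `Λ` yields the throughput `n / (2 d Λ)`, for every saturated demand. -/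
theorem exists_flow_of_scheme [Nonempty V] (hP : IsRoutingScheme N.graph S P) {Λ : ℝ}
    (hΛ : N.LoadLE S P Λ) (hd : 0 < nu * Γ) {θ : ℝ} (hθ : 0 < θ)
    (h : 2 * θ * (nu * Γ : ℕ) * Λ ≤ Fintype.card V)
    {M : V → V → ℝ} (hM : N.graph.IsSaturated M) :
    ∃ F : RouteFlow V, IsVLBFlow N.graph F ∧ N.graph.Serves F M θ ∧
      F.averageRouteLength M =
        2 * schemeSum S P (fun p => (p.length : ℝ)) / (Fintype.card V : ℝ) ^ 2 ∧
      ((∀ s t p, P s t p ≠ 0 → (s :: p.map fun h => h.1.2).Nodup) →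
        ∀ r ∈ F.support, r.HasSimpleLegs) := by
  have hs := slotShare_pos (N := N)
  have hc := N.linkCap_pos
  have hn : (0 : ℝ) < Fintype.card V := Nat.cast_pos.2 Fintype.card_pos
  have hd' : (0 : ℝ) < (nu * Γ : ℕ) := Nat.cast_pos.2 hd
  -- `K s t` is the flow per intermediate node, whence the division by the number of nodes; dividing
  -- by `slotShare` converts average demand into flow per period. All row and column sums of `K`
  -- equal `κ`.
  set K : V → V → ℝ := fun s t => θ / (N.graph.slotShare * Fintype.card V) * M s t with hK
  set κ : ℝ := θ * N.linkCap * (nu * Γ : ℕ) / Fintype.card V with hκ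
  have hrow (s : V) : ∑ t, K s t = κ := by
    rw [hK, ← Finset.mul_sum, hM.row, outCapacity_graph, hκ]
    field_simp
  have hcol (t : V) : ∑ s, K s t = κ := by
    rw [hK, ← Finset.mul_sum, hM.col, inCapacity_graph, hκ]
    field_simp
  have hK0 (s t : V) : 0 ≤ K s t := mul_nonneg (by positivity) (hM.nonneg s t)
  have hκ0 : 0 ≤ κ := by positivity
  have hpair (s t : V) : (schemeFlow N.graph S P K).pairFlow s t =
      θ / N.graph.slotShare * M s t := by
    rw [hP.pairFlow_schemeFlow, hK]
    field_simp
  refine ⟨schemeFlow N.graph S P K, hP.isVLBFlow_schemeFlow hK0 hrow hcol fun x hx => ?_,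
    fun s t => ?_, ?_, fun hS => IsRoutingScheme.hasSimpleLegs hS⟩
  · rw [cap_graph]
    calc 2 * κ * schemeSum S P (fun p => (p.count x : ℝ))
        ≤ 2 * κ * (Λ * N.linkCount x) := mul_le_mul_of_nonneg_left (hΛ x hx) (by positivity)
      _ = (2 * θ * (nu * Γ : ℕ) * Λ / Fintype.card V) * (N.linkCap * N.linkCount x) := by
        rw [hκ]; ring
      _ ≤ 1 * (N.linkCap * N.linkCount x) := by
        refine mul_le_mul_of_nonneg_right ((div_le_one hn).2 h) (by positivity)
      _ = _ := one_mul _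
  · rw [hpair]
    field_simp
    exact le_rfl
  · rw [RouteFlow.averageRouteLength_eq (hP.schemeFlow_nonneg hK0)
      (c := θ / N.graph.slotShare) (by positivity) hpair,
      hP.routeSum_length_schemeFlow hrow hcol]
    simp only [hM.row, outCapacity_graph, Finset.sum_const, Finset.card_univ, nsmul_eq_mul, hκ]
    field_simp

end MarsNetwork

/-! ### Simple walks and compactness -/

namespace PeriodicEvolvingGraph

variable {V : Type*} {G : PeriodicEvolvingGraph V}

theorem IsLabelledWalk.source_eq {s t s' t' : V} {p : List (Hop V)} (h : G.IsLabelledWalk s t p)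
    (h' : G.IsLabelledWalk s' t' p) (hp : p ≠ []) : s = s' := by
  cases p with
  | nil => exact absurd rfl hp
  | cons a p => exact h.2.2.1.symm.trans h'.2.2.1

variable (G)

/-- Targets do not repeat, so the length is bounded by the number of vertices; labels lie below the
period. -/
theorem finite_simpleWalks [Finite V] :
    {p | ∃ s t, G.IsLabelledWalk s t p ∧ (s :: p.map fun h => h.1.2).Nodup}.Finite := by
  have := Fintype.ofFinite V
  refine ((List.finite_length_le ((V × V) × Fin G.period) (Fintype.card V)).image
    (List.map fun h => (h.1, (h.2 : ℕ)))).subset ?_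
  rintro p ⟨s, t, h1, h2⟩
  refine ⟨p.map fun h => (h.1, ⟨h.2 % G.period, Nat.mod_lt _ G.period_pos⟩), ?_, ?_⟩
  · have := (List.nodup_cons.1 h2).2.length_le_card
    simpa using this
  · rw [List.map_map]
    refine (List.map_congr_left fun h hh => ?_).trans p.map_id
    simp [Nat.mod_eq_of_lt (h1.edge_of_mem hh).2]

/-- The walks in the emulated graph that visit no vertex twice. -/
noncomputable def simpleWalks [Finite V] : Finset (List (Hop V)) := G.finite_simpleWalks.toFinset

variable {G}

theorem IsLabelledWalk.mem_simpleWalks [Finite V] {s t : V} {p : List (Hop V)}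
    (h : G.IsLabelledWalk s t p) :
    p ∈ G.simpleWalks ↔ (s :: p.map fun h => h.1.2).Nodup := by
  rw [simpleWalks, Set.Finite.mem_toFinset]
  refine ⟨?_, fun h' => ⟨s, t, h, h'⟩⟩
  rintro ⟨s', t', h1, h2⟩
  rcases eq_or_ne p [] with rfl | hp
  · simp
  · rwa [h.source_eq h1 hp]

end PeriodicEvolvingGraph

/-- A closed subset of a product of unit intervals. The product has infinitely many factors, one for
each list of hops, so Tychonoff's theorem is applied. -/
theorem isCompact_schemes {V : Type*} (G : PeriodicEvolvingGraph V)
    (S : Finset (List (Hop V))) :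
    IsCompact {P | IsRoutingScheme G S P} := by
  have h1 : IsCompact (Set.univ.pi fun _ : V => Set.univ.pi fun _ : V =>
      Set.univ.pi fun _ : List (Hop V) => Set.Icc (0 : ℝ) 1) :=
    isCompact_univ_pi fun _ => isCompact_univ_pi fun _ => isCompact_univ_pi fun _ => isCompact_Icc
  refine h1.of_isClosed_subset ?_ fun P hP => ?_
  · have h2 : {P | IsRoutingScheme G S P} =
        (⋂ s, ⋂ t, ⋂ p, {P | 0 ≤ P s t p}) ∩
        (⋂ s, ⋂ t, ⋂ p, {P | ¬ (p ∈ S ∧ G.IsLabelledWalk s t p) → P s t p = 0}) ∩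
        (⋂ s, ⋂ t, {P | ∑ p ∈ S, P s t p = 1}) := by
      ext P
      simp only [Set.mem_ofPred_eq, Set.mem_inter_iff, Set.mem_iInter]
      refine ⟨fun h => ⟨⟨h.nonneg, fun s t p => ?_⟩, h.total⟩, fun h => ⟨h.1.1, fun s t p => ?_, h.2⟩⟩
      · exact not_imp_comm.1 (h.legal s t p)
      · exact not_imp_comm.1 (h.1.2 s t p)
    rw [h2]
    refine (IsClosed.inter ?_ ?_).inter ?_
    · exact isClosed_iInter fun s => isClosed_iInter fun t => isClosed_iInter fun p =>
        isClosed_le continuous_const (by fun_prop)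
    · refine isClosed_iInter fun s => isClosed_iInter fun t => isClosed_iInter fun p => ?_
      by_cases h : p ∈ S ∧ G.IsLabelledWalk s t p
      · simp [h]
      · simp only [h, not_false_eq_true, true_imp_iff]
        exact isClosed_eq (by fun_prop) continuous_const
    · exact isClosed_iInter fun s => isClosed_iInter fun t =>
        isClosed_eq (by fun_prop) continuous_const
  · refine fun s _ t _ p _ => ⟨hP.nonneg s t p, ?_⟩
    by_cases hp : P s t p = 0
    · rw [hp]
      exact zero_le_one
    · rw [← hP.total s t]
      exact Finset.single_le_sum (fun p _ => hP.nonneg s t p) (hP.legal s t p hp).1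

/-! ### From flows to routing schemes of least load -/

namespace MarsNetwork

variable {V : Type*} [Fintype V] [DecidableEq V] {nu Γ : ℕ} [NeZero Γ] {N : MarsNetwork V nu Γ}
  {S : Finset (List (Hop V))} {P : V → V → List (Hop V) → ℝ}

theorem sum_count_hopSet {s t : V} {p : List (Hop V)} (hp : N.graph.IsLabelledWalk s t p) :
    ∑ x ∈ hopSet V Γ, p.count x = p.length := by
  induction p generalizing s with
  | nil => simp
  | cons a p ih =>
    have ha : a ∈ hopSet V Γ := mem_hopSet.2 hp.2.1
    simp [List.count_cons, Finset.sum_add_distrib, ih hp.2.2.2, ha]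

theorem schemeSum_length (hP : IsRoutingScheme N.graph S P) :
    schemeSum S P (fun p => (p.length : ℝ)) =
      ∑ x ∈ hopSet V Γ, schemeSum S P fun p => (p.count x : ℝ) := by
  rw [← schemeSum_sum]
  refine schemeSum_congr fun s t p hp => ?_
  rw [← sum_count_hopSet (hP.legal s t p hp).2, Nat.cast_sum]

/-- Sums the load bound over all `n d` links. -/
theorem schemeSum_length_le (hP : IsRoutingScheme N.graph S P) {Λ : ℝ} (hΛ : N.LoadLE S P Λ) :
    schemeSum S P (fun p => (p.length : ℝ)) ≤ Λ * (Fintype.card V * (nu * Γ : ℕ)) := by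
  rw [schemeSum_length hP, ← Nat.cast_mul, ← sum_linkCount (N := N), Nat.cast_sum, Finset.mul_sum]
  exact Finset.sum_le_sum fun x hx => hΛ x (mem_hopSet.1 hx)

theorem schemeSum_length_pos [Nontrivial V] (hP : IsRoutingScheme N.graph S P) :
    0 < schemeSum S P (fun p => (p.length : ℝ)) := by
  obtain ⟨s, t, hst⟩ := exists_pair_ne V
  have h0 (s t p) : 0 ≤ P s t p * (p.length : ℝ) := mul_nonneg (hP.nonneg _ _ _) (Nat.cast_nonneg _)
  refine Finset.sum_pos' (fun _ _ => Finset.sum_nonneg fun _ _ => Finset.sum_nonneg fun _ _ =>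
    h0 _ _ _) ⟨s, Finset.mem_univ _, ?_⟩
  refine Finset.sum_pos' (fun _ _ => Finset.sum_nonneg fun _ _ => h0 _ _ _)
    ⟨t, Finset.mem_univ _, ?_⟩
  obtain ⟨p, hp, h⟩ := Finset.exists_ne_zero_of_sum_ne_zero ((hP.total s t).trans_ne one_ne_zero)
  refine Finset.sum_pos' (fun _ _ => h0 _ _ _) ⟨p, hp, mul_pos ((hP.nonneg _ _ _).lt_of_ne' h) ?_⟩
  refine Nat.cast_pos.2 (List.length_pos_iff.2 ?_)
  rintro rfl
  exact hst (hP.legal s t _ h).2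

theorem loadLE_pos [Nontrivial V] (hP : IsRoutingScheme N.graph S P) {Λ : ℝ}
    (hΛ : N.LoadLE S P Λ) : 0 < Λ := by
  by_contra! h
  have h1 := (schemeSum_length_pos hP).trans_le (schemeSum_length_le hP hΛ)
  exact h1.not_ge (mul_nonpos_of_nonpos_of_nonneg h (by positivity))

/-- A weighted family of walks that joins every pair of vertices by walks of total weight at least
`q` can be normalized to a routing scheme. -/
theorem exists_scheme_of_family {ι : Type*} (I : Finset ι) (a b : ι → V) (p : ι → List (Hop V))
    (ω : ι → ℝ) (hω : ∀ i ∈ I, 0 ≤ ω i)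
    (hp : ∀ i ∈ I, p i ∈ S ∧ N.graph.IsLabelledWalk (a i) (b i) (p i)) {q Λ : ℝ} (hq : 0 < q)
    (htot : ∀ s t, q ≤ ∑ i ∈ I with a i = s ∧ b i = t, ω i)
    (hload : ∀ x : Hop V, x.2 < Γ → ∑ i ∈ I, ω i * (p i).count x ≤ q * Λ * N.linkCount x) :
    ∃ P, IsRoutingScheme N.graph S P ∧ N.LoadLE S P Λ ∧
      ∀ s t p', P s t p' ≠ 0 → ∃ i ∈ I, p i = p' := by
  -- Each pair is normalized by its actual weight `T s t`; since this is at least `q`, loads are at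
  -- most those obtained by dividing by `q`.
  set T : V → V → ℝ := fun s t => ∑ i ∈ I with a i = s ∧ b i = t, ω i with hT
  have hT0 (s t) : 0 < T s t := hq.trans_le (htot s t)
  have hS (f : ι → ℝ) (s t : V) : ∑ p' ∈ S, ∑ i ∈ I with a i = s ∧ b i = t ∧ p i = p', f i =
      ∑ i ∈ I with a i = s ∧ b i = t, f i := by
    rw [← Finset.sum_fiberwise_of_maps_to (s := I.filter _) (t := S) (g := p)
      fun i hi => (hp i (Finset.mem_filter.1 hi).1).1]
    simp only [Finset.filter_filter, and_assoc]
  refine ⟨fun s t p' => (∑ i ∈ I with a i = s ∧ b i = t ∧ p i = p', ω i) / T s t,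
    ⟨fun s t p' => div_nonneg (Finset.sum_nonneg fun i hi => hω i (Finset.mem_filter.1 hi).1)
      (hT0 s t).le, fun s t p' h => ?_, fun s t => ?_⟩, fun x hx => ?_, fun s t p' h => ?_⟩
  · obtain ⟨i, hi, -⟩ := Finset.exists_ne_zero_of_sum_ne_zero (div_ne_zero_iff.1 h).1
    obtain ⟨hi', rfl, rfl, rfl⟩ := Finset.mem_filter.1 hi
    exact hp i hi'
  · rw [← Finset.sum_div, hS, div_self (hT0 s t).ne']
  · have h1 (s t : V) : ∑ p' ∈ S, (∑ i ∈ I with a i = s ∧ b i = t ∧ p i = p', ω i) / T s t *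
        (p'.count x : ℝ) ≤ q⁻¹ * ∑ i ∈ I with a i = s ∧ b i = t, ω i * (p i).count x := by
      rw [← hS, Finset.mul_sum]
      refine Finset.sum_le_sum fun p' _ => ?_
      have h2 : ∑ i ∈ I with a i = s ∧ b i = t ∧ p i = p', ω i * ((p i).count x : ℝ) =
          (∑ i ∈ I with a i = s ∧ b i = t ∧ p i = p', ω i) * (p'.count x : ℝ) := by
        rw [Finset.sum_mul]
        exact Finset.sum_congr rfl fun i hi => by rw [(Finset.mem_filter.1 hi).2.2.2]
      rw [h2, ← mul_assoc, div_eq_inv_mul]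
      refine mul_le_mul_of_nonneg_right (mul_le_mul_of_nonneg_right
        (inv_anti₀ hq (htot s t)) ?_) (Nat.cast_nonneg _)
      exact Finset.sum_nonneg fun i hi => hω i (Finset.mem_filter.1 hi).1
    calc _ ≤ ∑ s, ∑ t, q⁻¹ * ∑ i ∈ I with a i = s ∧ b i = t, ω i * (p i).count x :=
          Finset.sum_le_sum fun s _ => Finset.sum_le_sum fun t _ => h1 s t
      _ = q⁻¹ * ∑ i ∈ I, ω i * (p i).count x := by
        rw [← Finset.sum_fiberwise I fun i => (a i, b i), Fintype.sum_prod_type]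
        simp only [Prod.mk.injEq, Finset.mul_sum]
      _ ≤ q⁻¹ * (q * Λ * N.linkCount x) :=
        mul_le_mul_of_nonneg_left (hload x hx) (inv_nonneg.2 hq.le)
      _ = _ := by field_simp
  · obtain ⟨i, hi, -⟩ := Finset.exists_ne_zero_of_sum_ne_zero (div_ne_zero_iff.1 h).1
    obtain ⟨hi', -, -, h'⟩ := Finset.mem_filter.1 hi
    exact ⟨i, hi', h'⟩

/-- As `exists_scheme_of_family`, with walks that visit no vertex twice. -/
theorem exists_simple_scheme_of_family {ι : Type*} (I : Finset ι) (a b : ι → V)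
    (p : ι → List (Hop V)) (ω : ι → ℝ) (hω : ∀ i ∈ I, 0 ≤ ω i)
    (hp : ∀ i ∈ I, N.graph.IsLabelledWalk (a i) (b i) (p i)) {q Λ : ℝ} (hq : 0 < q)
    (htot : ∀ s t, q ≤ ∑ i ∈ I with a i = s ∧ b i = t, ω i)
    (hload : ∀ x : Hop V, x.2 < Γ → ∑ i ∈ I, ω i * (p i).count x ≤ q * Λ * N.linkCount x) :
    ∃ P, IsRoutingScheme N.graph N.graph.simpleWalks P ∧ N.LoadLE N.graph.simpleWalks P Λ := by
  -- The simple walk is a sublist of the original one, so it uses no link more often.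
  have h (i : ι) : ∃ p' : List (Hop V), i ∈ I → p'.Sublist (p i) ∧
      N.graph.IsLabelledWalk (a i) (b i) p' ∧ (a i :: p'.map fun h => h.1.2).Nodup := by
    by_cases hi : i ∈ I
    · obtain ⟨p', h⟩ := (hp i hi).exists_simple
      exact ⟨p', fun _ => h⟩
    · exact ⟨[], fun h => absurd h hi⟩
  choose p' hp' using h
  obtain ⟨P, hP, hΛ, -⟩ := exists_scheme_of_family (S := N.graph.simpleWalks) I a b p' ω hω
    (fun i hi => ⟨(hp' i hi).2.1.mem_simpleWalks.2 (hp' i hi).2.2, (hp' i hi).2.1⟩) hq htot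
    (fun x hx => (Finset.sum_le_sum fun i hi => mul_le_mul_of_nonneg_left
      (Nat.cast_le.2 ((hp' i hi).1.count_le x)) (hω i hi)).trans (hload x hx))
  exact ⟨P, hP, hΛ⟩

/-- Every Valiant load balancing flow yields a routing scheme. -/
theorem exists_simple_scheme_of_flow [Nonempty V] (hd : 0 < nu * Γ) {M : V → V → ℝ}
    (hM : N.graph.IsSaturated M) {F : RouteFlow V} (hF : IsVLBFlow N.graph F) {θ : ℝ} (hθ : 0 < θ)
    (hS : N.graph.Serves F M θ) :
    ∃ P, IsRoutingScheme N.graph N.graph.simpleWalks P ∧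
      N.LoadLE N.graph.simpleWalks P (Fintype.card V / (2 * θ * (nu * Γ : ℕ))) := by
  have hs := slotShare_pos (N := N)
  have hc := N.linkCap_pos
  have hn : (0 : ℝ) < Fintype.card V := Nat.cast_pos.2 Fintype.card_pos
  have hd' : (0 : ℝ) < (nu * Γ : ℕ) := Nat.cast_pos.2 hd
  have hvia (s w t : V) : θ * M s t / (N.graph.slotShare * Fintype.card V) ≤ F.viaFlow s w t := by
    rw [hF.balanced, ← div_div]
    refine div_le_div_of_nonneg_right ?_ hn.le
    rw [div_le_iff₀ hs, mul_comm (F.pairFlow s t)]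
    exact hS s t
  -- Every route contributes two walks, its first leg (`true`) and its second leg (`false`). A pair
  -- `(s, t)` receives at least `θ c d / n` from first legs, by the row sum at `s`, and as much from
  -- second legs, by the column sum at `t`; hence the value of `q`.
  refine exists_simple_scheme_of_family (F.support ×ˢ (Finset.univ : Finset Bool))
    (fun i => if i.2 then i.1.src else i.1.mid) (fun i => if i.2 then i.1.mid else i.1.dst)
    (fun i => N.graph.reduceHops (if i.2 then i.1.first else i.1.second)) (fun i => F i.1)
    (fun i _ => hF.nonneg i.1) ?_ (q := 2 * θ * N.linkCap * (nu * Γ : ℕ) / Fintype.card V)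
    (by positivity) ?_ ?_
  · rintro ⟨r, i⟩ hr
    have hl := hF.legal r (Finset.mem_product.1 hr).1
    cases i
    · exact hl.2.1.reduce
    · exact hl.1.reduce
  · intro s t
    rw [Finset.sum_filter, Finset.sum_product]
    simp only [Fintype.sum_bool, if_true, Bool.false_eq_true, if_false, Finset.sum_add_distrib]
    have h1 : ∑ t', F.viaFlow s t t' =
        ∑ r ∈ F.support, if r.src = s ∧ r.mid = t then F r else 0 := by
      simp only [RouteFlow.viaFlow_eq_routeSum, RouteFlow.routeSum]
      rw [Finset.sum_comm]
      refine Finset.sum_congr rfl fun r _ => ?_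
      simp only [← and_assoc, mul_ite, mul_one, mul_zero]
      by_cases h : r.src = s ∧ r.mid = t <;> simp [h]
    have h2 : ∑ s', F.viaFlow s' s t =
        ∑ r ∈ F.support, if r.mid = s ∧ r.dst = t then F r else 0 := by
      simp only [RouteFlow.viaFlow_eq_routeSum, RouteFlow.routeSum]
      rw [Finset.sum_comm]
      refine Finset.sum_congr rfl fun r _ => ?_
      simp only [mul_ite, mul_one, mul_zero]
      by_cases h : r.mid = s ∧ r.dst = t <;> simp [h]
    rw [← h1, ← h2]
    have h3 := Finset.sum_le_sum fun t' (_ : t' ∈ Finset.univ) => hvia s t t'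
    have h4 := Finset.sum_le_sum fun s' (_ : s' ∈ Finset.univ) => hvia s' s t
    rw [← Finset.sum_div, ← Finset.mul_sum, hM.row, outCapacity_graph] at h3
    rw [← Finset.sum_div, ← Finset.mul_sum, hM.col, inCapacity_graph] at h4
    refine le_trans (le_of_eq ?_) (add_le_add h3 h4)
    field_simp
    ring
  · intro x hx
    obtain ⟨k, hk⟩ := RouteFlow.exists_emulatedLoad_le_load hF x hx
    have h1 := hk.trans (hF.capacity _ _)
    have h2 : N.graph.cap (x.2 + k * N.graph.period) x.1 = N.linkCap * N.linkCount x := by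
      rw [cap_graph, ← linkCount_mod, period_graph, Nat.add_mul_mod_self_right, linkCount_mod]
    rw [h2] at h1
    refine (le_of_eq ?_).trans (h1.trans_eq ?_)
    · rw [Finset.sum_product]
      refine Finset.sum_congr rfl fun r _ => ?_
      simp [PeriodicEvolvingGraph.reduceHops, VLBRoute.hops, mul_add]
    · field_simp

/-- There is a routing scheme of least possible load. -/
theorem exists_optimal_scheme [Nonempty V] (hd : 0 < nu * Γ)
    (h : ∃ P, IsRoutingScheme N.graph S P) :
    ∃ P Λ, IsRoutingScheme N.graph S P ∧ N.LoadLE S P Λ ∧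
      ∀ P' Λ', IsRoutingScheme N.graph S P' → N.LoadLE S P' Λ' → Λ ≤ Λ' := by
  have hX : ((hopSet V Γ).filter fun x => 0 < N.linkCount x).Nonempty := by
    rw [Finset.filter_nonempty_iff]
    by_contra! h0
    have h1 := sum_linkCount (N := N)
    rw [Finset.sum_eq_zero fun x hx => Nat.le_zero.1 (h0 x hx)] at h1
    exact (Nat.mul_pos (Fintype.card_pos (α := V)) hd).ne h1
  -- The worst load per parallel link. Edges without links are left out of the maximum, since legal
  -- walks cannot use them.
  set f : (V → V → List (Hop V) → ℝ) → ℝ := fun P => Finset.sup' _ hX fun x =>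
    schemeSum S P (fun p => (p.count x : ℝ)) / N.linkCount x with hf
  have hf1 {P} (hP : IsRoutingScheme N.graph S P) : N.LoadLE S P (f P) := by
    intro x hx
    rcases Nat.eq_zero_or_pos (N.linkCount x) with h0 | h0
    · rw [h0, Nat.cast_zero, mul_zero, schemeSum_congr (ψ := fun _ => 0)]
      · simp [schemeSum]
      · intro s t p hp
        rw [Nat.cast_eq_zero, List.count_eq_zero]
        intro hxp
        exact h0.not_gt (linkCount_pos.2 ((hP.legal s t p hp).2.edge_of_mem hxp).1)
    · rw [← div_le_iff₀ (Nat.cast_pos.2 h0)]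
      exact Finset.le_sup' (fun x => schemeSum S P (fun p => (p.count x : ℝ)) / N.linkCount x)
        (Finset.mem_filter.2 ⟨mem_hopSet.2 hx, h0⟩)
  have hf2 {P Λ} (hΛ : N.LoadLE S P Λ) : f P ≤ Λ := by
    refine Finset.sup'_le _ _ fun x hx => ?_
    obtain ⟨h1, h2⟩ := Finset.mem_filter.1 hx
    rw [div_le_iff₀ (Nat.cast_pos.2 h2)]
    exact hΛ x (mem_hopSet.1 h1)
  have hf3 : Continuous f := by
    refine Continuous.finset_sup'_apply hX fun x _ => Continuous.div_const ?_ _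
    unfold schemeSum
    fun_prop
  obtain ⟨P, hP, hmin⟩ := (isCompact_schemes N.graph S).exists_isMinOn h hf3.continuousOn
  exact ⟨P, f P, hP, hf1 hP, fun P' Λ' hP' hΛ' => (hmin hP').trans (hf2 hΛ')⟩

end MarsNetwork

/-! ### Filling spare capacity with closed walks -/

namespace PeriodicEvolvingGraph

variable {V : Type*} {G : PeriodicEvolvingGraph V}

theorem IsLabelledWalk.target_mem {s t : V} {p : List (Hop V)} (h : G.IsLabelledWalk s t p)
    (hp : p ≠ []) : t ∈ p.map fun h => h.1.2 := by
  induction p generalizing s with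
  | nil => exact absurd rfl hp
  | cons a p ih =>
    rcases eq_or_ne p [] with rfl | hp
    · have : a.1.2 = t := h.2.2.2
      simp [this]
    · exact List.mem_cons_of_mem _ (ih h.2.2.2 hp)

/-- Along a map that sends every edge to a successor, one walks for ever. -/
theorem isLabelledWalk_iterate {A : Set (Hop V)} {f : Hop V → Hop V}
    (hA : ∀ a ∈ A, a.1 ∈ G.edges a.2 ∧ a.2 < G.period) (hf : ∀ a ∈ A, f a ∈ A ∧ (f a).1.1 = a.1.2)
    {a : Hop V} (ha : a ∈ A) (n : ℕ) :
    G.IsLabelledWalk a.1.1 (f^[n] a).1.1 (List.iterate f a n) ∧ ∀ b ∈ List.iterate f a n, b ∈ A := by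
  induction n generalizing a with
  | zero => exact ⟨rfl, by simp⟩
  | succ n ih =>
    obtain ⟨h1, h2⟩ := ih (hf a ha).1
    rw [List.iterate, Function.iterate_succ_apply]
    refine ⟨⟨(hA a ha).1, (hA a ha).2, rfl, (hf a ha).2 ▸ h1⟩, fun b hb => ?_⟩
    rcases List.mem_cons.1 hb with rfl | hb
    · exact ha
    · exact h2 b hb

/-- In a finite set of edges in which every edge has a successor, there is a closed walk. -/
theorem exists_closed_walk {A : Set (Hop V)} (hfin : A.Finite) (hne : A.Nonempty)
    (hA : ∀ a ∈ A, a.1 ∈ G.edges a.2 ∧ a.2 < G.period) (hs : ∀ a ∈ A, ∃ b ∈ A, b.1.1 = a.1.2) :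
    ∃ v p, p ≠ [] ∧ G.IsLabelledWalk v v p ∧ ∀ b ∈ p, b ∈ A := by
  have h (a : Hop V) : ∃ b, a ∈ A → b ∈ A ∧ b.1.1 = a.1.2 := by
    by_cases ha : a ∈ A
    · obtain ⟨b, hb⟩ := hs a ha
      exact ⟨b, fun _ => hb⟩
    · exact ⟨a, fun h => absurd h ha⟩
  choose f hf using h
  obtain ⟨a, ha⟩ := hne
  have hit (n : ℕ) : f^[n] a ∈ A := by
    induction n with
    | zero => exact ha
    | succ n ih =>
      rw [Function.iterate_succ_apply']
      exact (hf _ ih).1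
  obtain ⟨i, j, hij, h⟩ : ∃ i j, i < j ∧ f^[i] a = f^[j] a := by
    have := hfin.to_subtype
    obtain ⟨i, j, hij, h⟩ := Finite.exists_ne_map_eq_of_infinite fun n => (⟨f^[n] a, hit n⟩ : A)
    rcases hij.lt_or_gt with h' | h'
    · exact ⟨i, j, h', congrArg Subtype.val h⟩
    · exact ⟨j, i, h', (congrArg Subtype.val h).symm⟩
  obtain ⟨h1, h2⟩ := isLabelledWalk_iterate hA hf (hit i) (j - i)
  rw [← Function.iterate_add_apply, Nat.sub_add_cancel hij.le, ← h] at h1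
  refine ⟨_, _, ?_, h1, h2⟩
  rw [← List.length_pos_iff, List.length_iterate]
  omega

end PeriodicEvolvingGraph

/-- Moves the weight `η` from the empty walk at `v` to the closed walk `C` at `v`. -/
theorem IsRoutingScheme.exists_shift {V : Type*} [Fintype V] {G : PeriodicEvolvingGraph V}
    {S : Finset (List (Hop V))} {P : V → V → List (Hop V) → ℝ} (hP : IsRoutingScheme G S P)
    {v : V} {C : List (Hop V)} (hC : G.IsLabelledWalk v v C) (hC' : C ≠ []) {η : ℝ} (hη : 0 ≤ η)
    (hη' : η < P v v []) :
    ∃ S' P', IsRoutingScheme G S' P' ∧ (∀ s, 0 < P s s [] → 0 < P' s s []) ∧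
      ∀ φ, schemeSum S' P' φ = schemeSum S P φ + η * (φ C - φ []) := by
  classical
  have h0 : [] ∈ S := (hP.legal v v [] (hη.trans_lt hη').ne').1
  set S' := insert C S with hS'
  set P' : V → V → List (Hop V) → ℝ := fun s t p => P s t p +
    if s = v ∧ t = v then η * ((if p = C then 1 else 0) - if p = [] then 1 else 0) else 0 with hP'
  have hsum (s t : V) (φ : List (Hop V) → ℝ) : ∑ p ∈ S', P' s t p * φ p =
      ∑ p ∈ S, P s t p * φ p + if s = v ∧ t = v then η * (φ C - φ []) else 0 := by
    have h1 : ∑ p ∈ S, P s t p * φ p = ∑ p ∈ S', P s t p * φ p := by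
      refine Finset.sum_subset (Finset.subset_insert _ _) fun p _ hp => ?_
      rw [not_imp_comm.1 (hP.legal s t p) fun h => hp h.1, zero_mul]
    rw [h1]
    simp only [hP', add_mul, Finset.sum_add_distrib, add_right_inj]
    split_ifs with h2
    · have h3 : C ∈ S' := Finset.mem_insert_self _ _
      have h4 : [] ∈ S' := Finset.mem_insert_of_mem h0
      simp only [mul_assoc, sub_mul, ← Finset.mul_sum, Finset.sum_sub_distrib, ite_mul, one_mul,
        zero_mul, Finset.sum_ite_eq', h3, h4, if_true]
    · simp
  refine ⟨S', P', ⟨fun s t p => ?_, fun s t p h => ?_, fun s t => ?_⟩, fun s hs => ?_, fun φ => ?_⟩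
  · have h1 := hP.nonneg s t p
    simp only [hP']
    split_ifs with h2 h3 h4 h4
    · exact absurd (h3.symm.trans h4) hC'
    · linarith
    · obtain ⟨rfl, rfl⟩ := h2
      rw [h4]
      linarith
    · linarith
    · linarith
  · by_cases h1 : P s t p = 0
    · simp only [hP', h1, zero_add] at h
      split_ifs at h with h2 h3 h4 h4
      · exact absurd (h3.symm.trans h4) hC'
      · obtain ⟨rfl, rfl⟩ := h2
        exact ⟨h3 ▸ Finset.mem_insert_self _ _, h3 ▸ hC⟩
      · obtain ⟨rfl, rfl⟩ := h2
        rw [h4] at h1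
        linarith
      · simp at h
      · exact absurd rfl h
    · exact ⟨Finset.mem_insert_of_mem (hP.legal s t p h1).1, (hP.legal s t p h1).2⟩
  · have h1 := hsum s t fun _ => 1
    simpa [hP.total] using h1
  · simp only [hP', hC'.symm, if_false, if_true, and_self]
    split_ifs with h1
    · rw [h1]
      linarith
    · linarith
  · simp only [schemeSum, hsum, Finset.sum_add_distrib, add_right_inj]
    rw [Finset.sum_eq_single v (fun s _ hs => by simp [hs]) (by simp),
      Finset.sum_eq_single v (fun s _ hs => by simp [hs]) (by simp)]
    simp

namespace MarsNetwork

variable {V : Type*} [Fintype V] [DecidableEq V] {nu Γ : ℕ} [NeZero Γ] {N : MarsNetwork V nu Γ}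
  {S : Finset (List (Hop V))} {P : V → V → List (Hop V) → ℝ}

theorem sum_count_filter_hopSet {s t : V} {p : List (Hop V)} (hp : N.graph.IsLabelledWalk s t p)
    (q : Hop V → Prop) [DecidablePred q] :
    ∑ x ∈ hopSet V Γ with q x, p.count x = p.countP fun x => q x := by
  induction p generalizing s with
  | nil => simp
  | cons a p ih =>
    have ha : a ∈ hopSet V Γ := mem_hopSet.2 hp.2.1
    simp [List.count_cons, List.countP_cons, Finset.sum_add_distrib, ih hp.2.2.2, ha]

/-- The load of the uniform demand is a circulation. -/
theorem load_balanced (hP : IsRoutingScheme N.graph S P) (v : V) :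
    ∑ x ∈ hopSet V Γ with x.1.1 = v, schemeSum S P (fun p => (p.count x : ℝ)) =
      ∑ x ∈ hopSet V Γ with x.1.2 = v, schemeSum S P (fun p => (p.count x : ℝ)) := by
  rw [← schemeSum_sum, ← schemeSum_sum, ← sub_eq_zero]
  -- A walk contributes its start minus its end at `v`; over all ordered pairs these cancel.
  have h1 (s t : V) (p : List (Hop V)) :
      P s t p * (∑ x ∈ hopSet V Γ with x.1.1 = v, (p.count x : ℝ)) -
      P s t p * (∑ x ∈ hopSet V Γ with x.1.2 = v, (p.count x : ℝ)) =
      P s t p * ((if s = v then 1 else 0) - if t = v then 1 else 0) := by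
    by_cases hp : P s t p = 0
    · simp [hp]
    have hw := (hP.legal s t p hp).2
    have h2 := hw.countP_source_add v
    rw [← sum_count_filter_hopSet hw, ← sum_count_filter_hopSet hw] at h2
    have h3 : ∑ x ∈ hopSet V Γ with x.1.1 = v, (p.count x : ℝ) + (if t = v then 1 else 0) =
        ∑ x ∈ hopSet V Γ with x.1.2 = v, (p.count x : ℝ) + if s = v then 1 else 0 := by
      exact_mod_cast h2
    rw [← mul_sub]
    congr 1
    linarith
  simp only [schemeSum, ← Finset.sum_sub_distrib, h1, ← Finset.sum_mul, hP.total]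
  simp

/-- Spare capacity can be filled up by sending some traffic from nodes to themselves along closed
walks. -/
theorem exists_tight_scheme {Λ : ℝ} (hP : IsRoutingScheme N.graph S P) (hΛ : N.LoadLE S P Λ)
    (h0 : ∀ s, 0 < P s s []) :
    ∃ S' P', IsRoutingScheme N.graph S' P' ∧
      ∀ x : Hop V, x.2 < Γ → schemeSum S' P' (fun p => (p.count x : ℝ)) = Λ * N.linkCount x := by
  -- Induction on the number of links with spare capacity: each round fills at least one and creates
  -- none.
  induction hk : ((hopSet V Γ).filter fun x =>
      schemeSum S P (fun p => (p.count x : ℝ)) < Λ * N.linkCount x).card using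
      Nat.strong_induction_on generalizing S P with
  | _ k ih =>
    set A := (hopSet V Γ).filter fun x =>
      schemeSum S P (fun p => (p.count x : ℝ)) < Λ * N.linkCount x with hA
    have hmem {x} : x ∈ A ↔ x.2 < Γ ∧
        schemeSum S P (fun p => (p.count x : ℝ)) < Λ * N.linkCount x := by
      rw [hA, Finset.mem_filter, mem_hopSet]
    rcases A.eq_empty_or_nonempty with hne | hne
    · refine ⟨S, P, hP, fun x hx => le_antisymm (hΛ x hx) (not_lt.1 fun h => ?_)⟩
      exact Finset.notMem_empty x (hne ▸ hmem.2 ⟨hx, h⟩)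
    have hnn (x) : 0 ≤ schemeSum S P (fun p => (p.count x : ℝ)) :=
      Finset.sum_nonneg fun _ _ => Finset.sum_nonneg fun _ _ => Finset.sum_nonneg fun _ _ =>
        mul_nonneg (hP.nonneg _ _ _) (Nat.cast_nonneg _)
    obtain ⟨v, C, hC0, hC, hCA⟩ := PeriodicEvolvingGraph.exists_closed_walk (G := N.graph)
      (A := (A : Set (Hop V))) A.finite_toSet hne
      (fun a ha => by
        obtain ⟨h1, h2⟩ := hmem.1 ha
        refine ⟨linkCount_pos.1 (Nat.pos_of_ne_zero fun h => ?_), h1⟩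
        rw [h, Nat.cast_zero, mul_zero] at h2
        exact h2.not_ge (hnn a))
      (fun a ha => by
        -- Spare capacity is a nonnegative circulation, because both the load and the link counts
        -- are balanced at each vertex. If none left the head of `a`, none could enter it, but `a`
        -- does.
        by_contra! hb
        have h1 : ∑ x ∈ hopSet V Γ with x.1.1 = a.1.2,
            (Λ * N.linkCount x - schemeSum S P (fun p => (p.count x : ℝ))) = 0 := by
          refine Finset.sum_eq_zero fun x hx => ?_
          obtain ⟨h2, h3⟩ := Finset.mem_filter.1 hx
          refine sub_eq_zero.2 (le_antisymm (not_lt.1 fun h => ?_) (hΛ x (mem_hopSet.1 h2)))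
          exact hb x (hmem.2 ⟨mem_hopSet.1 h2, h⟩) h3
        have h2 : ∑ x ∈ hopSet V Γ with x.1.2 = a.1.2,
            (Λ * N.linkCount x - schemeSum S P (fun p => (p.count x : ℝ))) = 0 := by
          rw [← h1, Finset.sum_sub_distrib, Finset.sum_sub_distrib, load_balanced hP,
            ← Finset.mul_sum, ← Finset.mul_sum, ← Nat.cast_sum, ← Nat.cast_sum,
            sum_linkCount_source, sum_linkCount_target]
        obtain ⟨h3, h4⟩ := hmem.1 ha
        have h5 := (Finset.sum_eq_zero_iff_of_nonneg fun x hx => sub_nonneg.2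
          (hΛ x (mem_hopSet.1 (Finset.mem_filter.1 hx).1))).1 h2 a
          (Finset.mem_filter.2 ⟨mem_hopSet.2 h3, rfl⟩)
        linarith)
    have hCpos {x} (hx : x ∈ C) : (0 : ℝ) < C.count x := Nat.cast_pos.2 (List.count_pos_iff.2 hx)
    obtain ⟨x₀, hx₀, hmin⟩ := Finset.exists_min_image C.toFinset (fun x =>
      (Λ * N.linkCount x - schemeSum S P (fun p => (p.count x : ℝ))) / C.count x)
      ((List.toFinset_nonempty_iff _).2 hC0)
    rw [List.mem_toFinset] at hx₀
    -- The largest multiple of `C` that fits into the spare capacity; it makes `x₀` tight.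
    set y := (Λ * N.linkCount x₀ - schemeSum S P (fun p => (p.count x₀ : ℝ))) / C.count x₀ with hy
    have hy0 : 0 < y := div_pos (sub_pos.2 (hmem.1 (hCA x₀ hx₀)).2) (hCpos hx₀)
    -- The empty walk at `v` may have less weight than `y`. Going round `C` `K` times with weight `y
    -- / K` has the same load and leaves the empty walk positive weight for later rounds.
    obtain ⟨K, hK⟩ := exists_nat_gt (y / P v v [])
    have hK0 : (0 : ℝ) < K := (div_pos hy0 (h0 v)).trans hK
    obtain ⟨S', P', hP', h0', hφ⟩ := hP.exists_shift (hC.flatten_replicate K) (by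
        rw [Ne, List.flatten_eq_nil_iff]
        intro h
        exact hC0 (h C (List.mem_replicate.2 ⟨by rintro rfl; simp at hK0, rfl⟩)))
      (η := y / K) (by positivity) ((div_lt_comm₀ hK0 (h0 v)).2 hK)
    have hload (x) : schemeSum S' P' (fun p => (p.count x : ℝ)) =
        schemeSum S P (fun p => (p.count x : ℝ)) + y * C.count x := by
      rw [hφ]
      simp only [List.count_flatten, List.map_replicate, List.sum_replicate, smul_eq_mul,
        List.count_nil, Nat.cast_mul, Nat.cast_zero, sub_zero]
      field_simp
    have hyle {x} (hx : x ∈ C) : y * C.count x ≤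
        Λ * N.linkCount x - schemeSum S P (fun p => (p.count x : ℝ)) :=
      (le_div_iff₀ (hCpos hx)).1 (hmin x (List.mem_toFinset.2 hx))
    refine ih _ ?_ hP' (fun x hx => ?_) (fun s => h0' s (h0 s)) rfl
    · rw [← hk]
      refine Finset.card_lt_card (Finset.ssubset_iff_of_subset ?_ |>.2 ⟨x₀, hCA x₀ hx₀, ?_⟩)
      · intro x hx
        obtain ⟨h1, h2⟩ := Finset.mem_filter.1 hx
        refine hmem.2 ⟨mem_hopSet.1 h1, lt_of_le_of_lt ?_ h2⟩
        rw [hload]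
        exact le_add_of_nonneg_right (by positivity)
      · rw [Finset.mem_filter, not_and, not_lt, hload, hy, div_mul_cancel₀ _ (hCpos hx₀).ne']
        intro _
        linarith
    · rw [hload]
      by_cases hxC : x ∈ C
      · linarith [hyle hxC]
      · rw [List.count_eq_zero_of_not_mem hxC, Nat.cast_zero, mul_zero, add_zero]
        exact hΛ x hx

/-- The only closed walk without repeated vertices is empty. This supplies the weight on empty walks
that `exists_tight_scheme` needs. -/
theorem simple_scheme_self (hP : IsRoutingScheme N.graph N.graph.simpleWalks P) (s : V) :
    P s s [] = 1 := by
  have h (p) (hp : p ≠ []) : P s s p = 0 := by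
    by_contra h
    obtain ⟨h1, h2⟩ := hP.legal s s p h
    exact (List.nodup_cons.1 (h2.mem_simpleWalks.1 h1)).1 (h2.target_mem hp)
  rw [← hP.total s s, Finset.sum_eq_single [] (fun p _ => h p)]
  exact not_imp_comm.1 fun h => (hP.legal s s [] h).1

end MarsNetwork

/-! ### Average route length, exact throughput and bounds on the load -/

namespace MarsNetwork

/-- The Moore bound: a walk is determined by its start and its sequence of links. -/
theorem card_le_of_emulatedWalk {V : Type*} [DecidableEq V] {nu Γ : ℕ} [NeZero Γ]
    (N : MarsNetwork V nu Γ) (s : V) (k : ℕ) :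
    ∃ B : Finset V, B.card ≤ ∑ j ∈ Finset.range (k + 1), (nu * Γ) ^ j ∧
      ∀ j ≤ k, ∀ t, N.graph.EmulatedWalk j s t → t ∈ B := by
  refine ⟨(Finset.range (k + 1)).biUnion fun j => (linkWords nu Γ j).image (N.linksEnd s),
    Finset.card_biUnion_le.trans (Finset.sum_le_sum fun j _ =>
      Finset.card_image_le.trans_eq (card_linkWords nu Γ j)), fun j hj t ht => ?_⟩
  obtain ⟨w, hw, rfl⟩ := exists_linksEnd_eq_of_emulatedWalk ht
  exact Finset.mem_biUnion.2 ⟨j, Finset.mem_range.2 (Nat.lt_succ_of_le hj),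
    Finset.mem_image_of_mem _ hw⟩

variable {V : Type*} [Fintype V] [DecidableEq V] {nu Γ : ℕ} [NeZero Γ] {N : MarsNetwork V nu Γ}
  {S : Finset (List (Hop V))} {P : V → V → List (Hop V) → ℝ}

/-- Each hop of a route occupies capacity on one link, and the total capacity of a period is that of
`n d` links. -/
theorem routeSum_length_le {F : RouteFlow V} (hF : IsVLBFlow N.graph F) :
    F.routeSum (fun r => (r.length : ℝ)) ≤ N.linkCap * (Fintype.card V * (nu * Γ : ℕ)) := by
  have h1 : F.routeSum (fun r => (r.length : ℝ)) =
      ∑ x ∈ hopSet V Γ, F.emulatedLoad N.graph x := by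
    simp only [RouteFlow.emulatedLoad, RouteFlow.routeSum]
    rw [Finset.sum_comm]
    refine Finset.sum_congr rfl fun r hr => ?_
    rw [← Finset.mul_sum, ← Nat.cast_sum, sum_count_hopSet (hF.legal r hr).2.2.1.reduce]
    simp [PeriodicEvolvingGraph.reduceHops, VLBRoute.length]
  rw [h1, ← Nat.cast_mul, ← sum_linkCount (N := N), Nat.cast_sum, Finset.mul_sum]
  refine Finset.sum_le_sum fun x hx => ?_
  obtain ⟨k, hk⟩ := RouteFlow.exists_emulatedLoad_le_load hF x (mem_hopSet.1 hx)
  refine (hk.trans (hF.capacity _ _)).trans_eq ?_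
  rw [cap_graph, ← linkCount_mod, period_graph, Nat.add_mul_mod_self_right, linkCount_mod]

/-- The throughput is at most the inverse of the average route length. -/
theorem le_inv_averageRouteLength [Nontrivial V] (hd : 0 < nu * Γ) {M : V → V → ℝ}
    (hM : N.graph.IsSaturated M) {F : RouteFlow V} (hF : IsVLBFlow N.graph F) {θ : ℝ}
    (hS : N.graph.Serves F M θ) : θ ≤ 1 / F.averageRouteLength M := by
  classical
  have hs := slotShare_pos (N := N)
  have hc := N.linkCap_pos
  have hn : (0 : ℝ) < Fintype.card V := Nat.cast_pos.2 Fintype.card_pos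
  have hd' : (0 : ℝ) < (nu * Γ : ℕ) := Nat.cast_pos.2 hd
  have hMtot : ∑ a, ∑ b, M a b =
      Fintype.card V * (N.graph.slotShare * N.linkCap * (nu * Γ : ℕ)) := by
    simp only [hM.row, outCapacity_graph, Finset.sum_const, Finset.card_univ, nsmul_eq_mul]
  have hMpos : 0 < ∑ a, ∑ b, M a b := by
    rw [hMtot]
    positivity
  have hpf (s t : V) : 0 ≤ F.pairFlow s t := Finset.sum_nonneg fun r _ => hF.nonneg r
  have hterm (s t : V) (r : VLBRoute V) :
      0 ≤ M s t / (∑ a, ∑ b, M a b) * (F r / F.pairFlow s t) * (r.length : ℝ) :=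
    mul_nonneg (mul_nonneg (div_nonneg (hM.nonneg _ _) hMpos.le)
      (div_nonneg (hF.nonneg _) (hpf _ _))) (Nat.cast_nonneg _)
  have hA0 : 0 ≤ F.averageRouteLength M := Finset.sum_nonneg fun s _ => Finset.sum_nonneg fun t _ =>
    Finset.sum_nonneg fun r _ => hterm s t r
  rcases le_or_gt θ 0 with hθ | hθ
  · exact hθ.trans (one_div_nonneg.2 hA0)
  -- Needed because `1 / 0 = 0`. A pair with demand must send flow through some `w ≠ s`, and the
  -- first leg of such a route is not empty.
  have hA : 0 < F.averageRouteLength M := by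
    refine hA0.lt_of_ne' fun hA => ?_
    obtain ⟨s, -, h1⟩ := Finset.exists_ne_zero_of_sum_ne_zero hMpos.ne'
    obtain ⟨t, -, hst⟩ := Finset.exists_ne_zero_of_sum_ne_zero h1
    have hpos : 0 < F.pairFlow s t := by
      have h2 := mul_pos hθ ((hM.nonneg s t).lt_of_ne' hst)
      exact (mul_pos_iff_of_pos_left hs).1 (h2.trans_le (hS s t))
    obtain ⟨w, hw⟩ := exists_ne s
    have hvia : F.viaFlow s w t ≠ 0 := by
      rw [hF.balanced]
      positivity
    obtain ⟨r, hr, hr0⟩ := Finset.exists_ne_zero_of_sum_ne_zero hvia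
    simp only [Finset.mem_filter] at hr
    obtain ⟨hr, hsrc, hmid, hdst⟩ := hr
    have h3 := (Finset.sum_eq_zero_iff_of_nonneg fun s _ => Finset.sum_nonneg fun t _ =>
      Finset.sum_nonneg fun r _ => hterm s t r).1 hA s (Finset.mem_univ _)
    have h4 := (Finset.sum_eq_zero_iff_of_nonneg fun t _ =>
      Finset.sum_nonneg fun r _ => hterm s t r).1 h3 t (Finset.mem_univ _)
    have h5 := (Finset.sum_eq_zero_iff_of_nonneg fun r _ => hterm s t r).1 h4 r
      (by simp only [Finset.mem_filter]; exact ⟨hr, hsrc, hdst⟩)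
    have h6 : r.length ≠ 0 := by
      intro h
      have h7 : r.first = [] := by
        rw [VLBRoute.length, VLBRoute.hops, List.length_append] at h
        exact List.length_eq_zero_iff.1 (by omega)
      have h8 := (hF.legal r hr).1
      rw [h7] at h8
      exact hw (hmid.symm.trans (h8.symm.trans hsrc))
    have : (r.length : ℝ) ≠ 0 := Nat.cast_ne_zero.2 h6
    have : M s t / (∑ a, ∑ b, M a b) * (F r / F.pairFlow s t) * (r.length : ℝ) ≠ 0 := by
      positivity
    exact this h5
  rw [le_div_iff₀ hA]
  calc θ * F.averageRouteLength M
      ≤ N.graph.slotShare / (∑ a, ∑ b, M a b) * F.routeSum (fun r => (r.length : ℝ)) := by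
        rw [RouteFlow.routeSum_eq_sum_pairs, RouteFlow.averageRouteLength, Finset.mul_sum,
          Finset.mul_sum]
        refine Finset.sum_le_sum fun s _ => ?_
        rw [Finset.mul_sum, Finset.mul_sum]
        refine Finset.sum_le_sum fun t _ => ?_
        rw [Finset.mul_sum, Finset.mul_sum]
        refine le_trans (Finset.sum_le_sum fun r hr => ?_) (le_of_eq (Finset.sum_congr
          (by congr!) fun _ _ => rfl))
        -- For a pair without flow the quotient `F r / 0` is `0`, so its term vanishes.
        rcases (hpf s t).eq_or_lt' with h | h
        · rw [h, div_zero, mul_zero, zero_mul, mul_zero]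
          exact mul_nonneg (by positivity) (mul_nonneg (hF.nonneg r) (Nat.cast_nonneg _))
        · have h1 : θ * M s t / F.pairFlow s t ≤ N.graph.slotShare := (div_le_iff₀ h).2 (hS s t)
          have h2 : 0 ≤ F r * (r.length : ℝ) / ∑ a, ∑ b, M a b :=
            div_nonneg (mul_nonneg (hF.nonneg r) (Nat.cast_nonneg _)) hMpos.le
          calc _ = θ * M s t / F.pairFlow s t * (F r * (r.length : ℝ) / ∑ a, ∑ b, M a b) := by ring
            _ ≤ N.graph.slotShare * (F r * (r.length : ℝ) / ∑ a, ∑ b, M a b) :=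
              mul_le_mul_of_nonneg_right h1 h2
            _ = _ := by ring
    _ ≤ N.graph.slotShare / (∑ a, ∑ b, M a b) *
        (N.linkCap * (Fintype.card V * (nu * Γ : ℕ))) :=
      mul_le_mul_of_nonneg_left (routeSum_length_le hF) (by positivity)
    _ = 1 := by
      rw [hMtot]
      field_simp

theorem exists_isSaturated [Nonempty V] (N : MarsNetwork V nu Γ) :
    ∃ M, N.graph.IsSaturated M := by
  have hn : (Fintype.card V : ℝ) ≠ 0 := Nat.cast_ne_zero.2 Fintype.card_ne_zero
  refine ⟨fun _ _ => N.graph.slotShare * N.linkCap * (nu * Γ : ℕ) / Fintype.card V, ?_, ?_, ?_⟩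
  · intro s t
    have hs := slotShare_pos (N := N)
    have hc := N.linkCap_pos
    positivity
  · intro s
    rw [outCapacity_graph, Finset.sum_const, Finset.card_univ, nsmul_eq_mul]
    field_simp
  · intro s
    rw [inCapacity_graph, Finset.sum_const, Finset.card_univ, nsmul_eq_mul]
    field_simp

/-- The throughput is determined by the least load of a routing scheme. -/
theorem isGreatest_vlbAchievable [Nontrivial V] (hd : 0 < nu * Γ) {Λ : ℝ}
    (hP : IsRoutingScheme N.graph N.graph.simpleWalks P) (hΛ : N.LoadLE N.graph.simpleWalks P Λ)
    (hmin : ∀ P' Λ', IsRoutingScheme N.graph N.graph.simpleWalks P' →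
      N.LoadLE N.graph.simpleWalks P' Λ' → Λ ≤ Λ') {M : V → V → ℝ} (hM : N.graph.IsSaturated M) :
    IsGreatest (N.graph.vlbAchievable M) (Fintype.card V / (2 * (nu * Γ : ℕ) * Λ)) := by
  have hΛ0 := loadLE_pos hP hΛ
  have hn : (0 : ℝ) < Fintype.card V := Nat.cast_pos.2 Fintype.card_pos
  have hd' : (0 : ℝ) < (nu * Γ : ℕ) := Nat.cast_pos.2 hd
  constructor
  · obtain ⟨F, h1, h2, -⟩ := exists_flow_of_scheme hP hΛ hd
      (θ := Fintype.card V / (2 * (nu * Γ : ℕ) * Λ)) (by positivity)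
      (le_of_eq (by field_simp)) hM
    exact ⟨F, h1, h2⟩
  · rintro θ ⟨F, h1, h2⟩
    rcases le_or_gt θ 0 with hθ | hθ
    · exact hθ.trans (by positivity)
    obtain ⟨P', hP', hΛ'⟩ := exists_simple_scheme_of_flow hd hM h1 hθ h2
    have h := hmin _ _ hP' hΛ'
    rw [le_div_iff₀ (by positivity)] at h ⊢
    linarith

/-- One walk of at most `D` edges for every pair of vertices. -/
theorem exists_simple_scheme_of_emulatedDiamLE {D : ℕ} (hD : N.graph.EmulatedDiamLE D) :
    ∃ P, IsRoutingScheme N.graph N.graph.simpleWalks P ∧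
      N.LoadLE N.graph.simpleWalks P
        (∑ k ∈ Finset.range (D + 1), k * (nu * Γ) ^ (k - 1) : ℕ) := by
  have h (s t : V) : ∃ w : List (Fin nu × Fin Γ), w.length ≤ D ∧ N.linksEnd s w = t := by
    obtain ⟨k, hk, h⟩ := hD s t
    obtain ⟨w, hw, rfl⟩ := exists_linksEnd_eq_of_emulatedWalk h
    exact ⟨w, (mem_linkWords.1 hw).trans_le hk, rfl⟩
  choose w hw hend using h
  refine exists_simple_scheme_of_family (Finset.univ : Finset (V × V)) Prod.fst Prod.snd
    (fun i => N.followLinks i.1 (w i.1 i.2)) (fun _ => 1) (fun _ _ => zero_le_one) (fun i _ => ?_)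
    one_pos (fun s t => ?_) fun x hx => ?_
  · have := isLabelledWalk_followLinks (N := N) i.1 (w i.1 i.2)
    rwa [hend] at this
  · rw [Finset.sum_eq_card_nsmul (b := 1) fun _ _ => rfl, nsmul_eq_mul, mul_one, Nat.one_le_cast]
    exact Finset.card_pos.2 ⟨(s, t), by simp⟩
  -- For fixed `s`, different ends `t` need different link sequences, so the chosen walks are among
  -- all walks from `s` of at most `D` edges. Summed over `s`, these use each link equally often by
  -- regularity.
  · have h1 (s : V) : ∑ t, (N.followLinks s (w s t)).count x ≤
        ∑ k ∈ Finset.range (D + 1), ∑ v ∈ linkWords nu Γ k, (N.followLinks s v).count x := by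
      rw [Finset.sum_sigma' (Finset.range (D + 1)) (linkWords nu Γ)
        fun _ v => (N.followLinks s v).count x]
      have hinj : Function.Injective fun t =>
          (⟨(w s t).length, w s t⟩ : (_ : ℕ) × List (Fin nu × Fin Γ)) := fun t t' h => by
        rw [← hend s t, ← hend s t', (Sigma.mk.inj_iff.1 h).2.eq]
      refine (Finset.sum_map Finset.univ ⟨_, hinj⟩
        fun v => (N.followLinks s v.2).count x).symm.trans_le ?_
      refine Finset.sum_le_sum_of_subset fun v hv => ?_
      obtain ⟨t, -, rfl⟩ := Finset.mem_map.1 hv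
      exact Finset.mem_sigma.2 ⟨Finset.mem_range.2 (Nat.lt_succ_of_le (hw s t)),
        mem_linkWords.2 rfl⟩
    have h2 := Finset.sum_le_sum fun s (_ : s ∈ Finset.univ) => h1 s
    rw [Finset.sum_comm (s := Finset.univ) (t := Finset.range (D + 1)),
      Finset.sum_congr rfl fun k _ => sum_count_followLinks (N := N) k hx, ← Finset.sum_mul] at h2
    rw [Fintype.sum_prod_type]
    simp only [one_mul]
    exact_mod_cast h2

/-- Few vertices are close to a given vertex, so the walks of a routing scheme are long. -/
theorem le_schemeSum_length (hP : IsRoutingScheme N.graph S P) (K : ℕ) :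
    (Fintype.card V : ℝ) * ∑ k ∈ Finset.range K,
      ((Fintype.card V : ℝ) - ∑ j ∈ Finset.range (k + 1), ((nu * Γ : ℕ) : ℝ) ^ j) ≤
    schemeSum S P fun p => (p.length : ℝ) := by
  choose B hB1 hB2 using card_le_of_emulatedWalk N
  -- `B s k` contains the ball of radius `k`, so if `t ∉ B s k` then every walk from `s` to `t` is
  -- longer than `k`.
  have h1 (s t : V) : (((Finset.range K).filter fun k => t ∉ B s k).card : ℝ) ≤
      ∑ p ∈ S, P s t p * (p.length : ℝ) := by
    rw [← one_mul (Nat.cast _), ← hP.total s t, Finset.sum_mul]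
    refine Finset.sum_le_sum fun p _ => ?_
    by_cases hp : P s t p = 0
    · simp [hp]
    refine mul_le_mul_of_nonneg_left (Nat.cast_le.2 ?_) (hP.nonneg s t p)
    rw [← Finset.card_range p.length]
    refine Finset.card_le_card fun k hk => Finset.mem_range.2 (not_le.1 fun h => ?_)
    exact (Finset.mem_filter.1 hk).2 (hB2 s k _ h t (hP.legal s t p hp).2.emulatedWalk)
  have h2 (s : V) : ∑ k ∈ Finset.range K,
      ((Fintype.card V : ℝ) - ∑ j ∈ Finset.range (k + 1), ((nu * Γ : ℕ) : ℝ) ^ j) ≤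
      ∑ t, (((Finset.range K).filter fun k => t ∉ B s k).card : ℝ) := by
    simp only [Finset.card_filter, Nat.cast_sum]
    rw [Finset.sum_comm]
    refine Finset.sum_le_sum fun k _ => ?_
    rw [← Nat.cast_sum, ← Finset.card_filter, ← Finset.compl_filter, Finset.card_compl,
      Nat.cast_sub (Finset.card_le_univ _)]
    refine sub_le_sub_left ?_ _
    have h3 : (Finset.univ.filter fun t => t ∈ B s k) = B s k := by ext; simp
    rw [h3]
    exact_mod_cast hB1 s k
  rw [← nsmul_eq_mul, ← Finset.card_univ, ← Finset.sum_const]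
  exact Finset.sum_le_sum fun s _ => (h2 s).trans (Finset.sum_le_sum fun t _ => h1 s t)

end MarsNetwork

/-! ### Elementary counting and estimates -/

theorem sum_range_mul_eq {β : Type*} [AddCommMonoid β] (f : ℕ → β) (a b : ℕ) :
    ∑ y ∈ Finset.range (a * b), f y =
      ∑ i ∈ Finset.range a, ∑ j ∈ Finset.range b, f (i * b + j) := by
  induction a with
  | zero => simp
  | succ a ih => rw [Nat.succ_mul, Finset.sum_range_add, ih, Finset.sum_range_succ]

/-- Among `L` consecutive integers each residue occurs at least `L / n` times. The shift `-c` is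
written as `c * (n - 1)`. -/
theorem div_le_card_filter_mod (c L : ℕ) {n t : ℕ} (ht : t < n) :
    L / n ≤ ((Finset.range L).filter fun y => (c + y) % n = t).card := by
  have h1 : (fun y => (c + y) % n = t) = fun y => y ≡ t + c * (n - 1) [MOD n] := by
    funext y
    have h2 : c + (t + c * (n - 1)) = t + c * n := by
      obtain ⟨k, rfl⟩ : ∃ k, n = k + 1 := ⟨n - 1, by omega⟩
      rw [Nat.add_sub_cancel]
      ring
    have h3 : y ≡ t + c * (n - 1) [MOD n] ↔ c + y ≡ c + (t + c * (n - 1)) [MOD n] :=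
      ⟨fun h => h.add_left c, fun h => Nat.ModEq.add_left_cancel' c h⟩
    rw [eq_iff_iff, h3, h2, Nat.ModEq, Nat.add_mul_mod_self_right, Nat.mod_eq_of_lt ht]
  simp only [h1]
  rw [← Nat.count_eq_card_filter_range, Nat.count_modEq_card _ (Nat.zero_lt_of_lt ht)]
  exact Nat.le_add_right _ _

theorem sub_one_mul_sum_le {d : ℝ} (hd : 1 ≤ d) (D : ℕ) :
    (d - 1) * ∑ k ∈ Finset.range (D + 1), (k : ℝ) * d ^ (k - 1) ≤ D * d ^ D := by
  induction D with
  | zero => simp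
  | succ D ih =>
    rw [Finset.sum_range_succ, mul_add, Nat.add_sub_cancel]
    have h1 : 0 < d ^ D := by positivity
    push_cast
    rw [pow_succ]
    nlinarith

/-- The geometric estimate `(d - 1) * (1 + ... + d^(m-1)) ≤ d^m`, applied to the inner and to the
outer sum. -/
theorem sq_mul_sum_geom_le {d : ℝ} (hd : 1 < d) (K : ℕ) :
    (d - 1) ^ 2 * ∑ k ∈ Finset.range K, ∑ j ∈ Finset.range (k + 1), d ^ j ≤ d * d ^ K := by
  have h1 (m : ℕ) : (d - 1) * ∑ j ∈ Finset.range m, d ^ j ≤ d ^ m := by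
    rw [mul_comm, geom_sum_mul]
    linarith
  calc _ = (d - 1) * ∑ k ∈ Finset.range K, (d - 1) * ∑ j ∈ Finset.range (k + 1), d ^ j := by
        rw [← Finset.mul_sum]; ring
    _ ≤ (d - 1) * ∑ k ∈ Finset.range K, d ^ (k + 1) :=
      mul_le_mul_of_nonneg_left (Finset.sum_le_sum fun k _ => h1 (k + 1)) (by linarith)
    _ = d * ((d - 1) * ∑ k ∈ Finset.range K, d ^ k) := by
      simp only [pow_succ, ← Finset.sum_mul]; ring
    _ ≤ _ := mul_le_mul_of_nonneg_left (h1 K) (by linarith)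

/-! ### De Bruijn digraphs -/

namespace MarsNetwork

/-- Every step appends a base-`d` digit to the current number, so a walk of `m` steps amounts to
appending a number `y < d^m`. The induction splits off the leading digit, `y = a * d^m + y'`. -/
theorem card_linkWords_deBruijn {V : Type*} [Fintype V] [DecidableEq V] {nu Γ : ℕ}
    {N : MarsNetwork V nu Γ} {d : ℕ} {φ : V ≃ Fin (Fintype.card V)}
    (hφ : ∀ u v, N.multiplicity u v = ((Finset.range d).filter
      (fun a => ((φ u : ℕ) * d + a) % Fintype.card V = (φ v : ℕ))).card) (m : ℕ) (s t : V) :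
    ((linkWords nu Γ m).filter fun w => N.linksEnd s w = t).card =
      ((Finset.range (d ^ m)).filter fun y =>
        ((φ s : ℕ) * d ^ m + y) % Fintype.card V = (φ t : ℕ)).card := by
  induction m generalizing s with
  | zero =>
    simp only [linkWords, pow_zero, Finset.range_one, mul_one, Finset.card_filter,
      Finset.sum_singleton, linksEnd, add_zero, Nat.mod_eq_of_lt (φ s).2, Fin.val_inj,
      φ.injective.eq_iff]
    congr
  | succ m ih =>
    have h1 (u : ℕ) (a : ℕ) : ∑ y ∈ Finset.range (d ^ m),
        (if (u * d ^ (m + 1) + (a * d ^ m + y)) % Fintype.card V = (φ t : ℕ) then 1 else 0) =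
        ∑ y ∈ Finset.range (d ^ m),
        if ((u * d + a) % Fintype.card V * d ^ m + y) % Fintype.card V = (φ t : ℕ)
          then 1 else 0 := by
      refine Finset.sum_congr rfl fun y _ => ?_
      have h2 : (u * d ^ (m + 1) + (a * d ^ m + y)) % Fintype.card V =
          ((u * d + a) % Fintype.card V * d ^ m + y) % Fintype.card V := by
        rw [show u * d ^ (m + 1) + (a * d ^ m + y) = (u * d + a) * d ^ m + y by ring]
        exact (((Nat.mod_modEq _ _).mul_right _).add_right _).symm
      rw [h2]
    have h3 : ∑ a : Fin nu × Fin Γ, ((linkWords nu Γ m).filter fun w =>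
        N.linksEnd (N.matching a.1 a.2 s) w = t).card =
        ∑ v, N.multiplicity s v * ((linkWords nu Γ m).filter fun w => N.linksEnd v w = t).card := by
      rw [← Finset.sum_fiberwise Finset.univ fun a : Fin nu × Fin Γ => N.matching a.1 a.2 s]
      refine Finset.sum_congr rfl fun v _ => ?_
      rw [multiplicity, ← smul_eq_mul, ← Finset.sum_const]
      exact Finset.sum_congr rfl fun a ha => by rw [(Finset.mem_filter.1 ha).2]
    have h5 : ((linkWords nu Γ (m + 1)).filter fun w => N.linksEnd s w = t).card =
        ∑ a : Fin nu × Fin Γ, ((linkWords nu Γ m).filter fun w =>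
          N.linksEnd (N.matching a.1 a.2 s) w = t).card := by
      rw [Finset.card_filter, sum_linkWords_succ]
      exact Finset.sum_congr rfl fun a _ => (Finset.card_filter _ _).symm
    rw [h5, h3, Finset.card_filter, pow_succ', sum_range_mul_eq, ← pow_succ']
    simp only [h1, ih, hφ]
    have h4 (v : V) (a : ℕ) : ((φ s : ℕ) * d + a) % Fintype.card V = (φ v : ℕ) ↔
        v = φ.symm ⟨((φ s : ℕ) * d + a) % Fintype.card V, Nat.mod_lt _ (φ s).pos⟩ := by
      rw [Equiv.eq_symm_apply, Fin.ext_iff, eq_comm]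
    simp only [Finset.card_filter _ (Finset.range d), Finset.sum_mul]
    rw [Finset.sum_comm]
    refine Finset.sum_congr rfl fun a _ => ?_
    simp only [h4, ite_mul, one_mul, zero_mul, Finset.sum_ite_eq', Finset.mem_univ, if_true,
      Finset.card_filter, Equiv.apply_symm_apply]

variable {V : Type*} [Fintype V] [DecidableEq V] {nu Γ : ℕ} [NeZero Γ] {N : MarsNetwork V nu Γ}
  {S : Finset (List (Hop V))} {P : V → V → List (Hop V) → ℝ}

/-- The routing scheme that uses equally many walks of length `m` for every pair of vertices. -/
theorem exists_scheme_of_linkWords {m q : ℕ} (hq : 0 < q)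
    (h : ∀ s t, q ≤ ((linkWords nu Γ m).filter fun w => N.linksEnd s w = t).card) :
    ∃ S P, IsRoutingScheme N.graph S P ∧
      N.LoadLE S P ((m * (nu * Γ) ^ (m - 1) : ℕ) / (q : ℝ)) ∧
      ∀ s t p, P s t p ≠ 0 → p.length = m := by
  choose T hT hTq using fun s t => Finset.exists_subset_card_eq (h s t)
  set I : Finset (V × V × List (Fin nu × Fin Γ)) :=
    (Finset.univ ×ˢ Finset.univ ×ˢ linkWords nu Γ m).filter fun i => i.2.2 ∈ T i.1 i.2.1 with hI
  have hmem {i} (hi : i ∈ I) : i.2.2 ∈ linkWords nu Γ m ∧ N.linksEnd i.1 i.2.2 = i.2.1 :=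
    Finset.mem_filter.1 (hT _ _ (Finset.mem_filter.1 hi).2)
  have hq' : (0 : ℝ) < q := Nat.cast_pos.2 hq
  have hwalk (i) (hi : i ∈ I) :
      N.graph.IsLabelledWalk i.1 i.2.1 (N.followLinks i.1 i.2.2) := by
    rw [← (hmem hi).2]
    exact isLabelledWalk_followLinks _ _
  have htot (s t : V) : (q : ℝ) ≤ ∑ i ∈ I with i.1 = s ∧ i.2.1 = t, 1 := by
    rw [Finset.sum_const, nsmul_eq_mul, mul_one, Nat.cast_le, ← hTq s t]
    refine Finset.card_le_card_of_injOn (fun w => (s, t, w)) (fun w hw => ?_) fun w _ w' _ hww => ?_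
    · simp only [hI, Finset.coe_filter, Finset.mem_filter, Finset.mem_product, Finset.mem_univ,
        true_and, and_true, Set.mem_ofPred_eq, and_self]
      exact ⟨(Finset.mem_filter.1 (hT s t hw)).1, hw⟩
    · simpa using hww
  have hload (x : Hop V) (hx : x.2 < Γ) : ∑ i ∈ I, (1 : ℝ) * (N.followLinks i.1 i.2.2).count x ≤
      q * ((m * (nu * Γ) ^ (m - 1) : ℕ) / (q : ℝ)) * N.linkCount x := by
    rw [mul_div_cancel₀ _ hq'.ne']
    have h1 : ∑ i ∈ I, (N.followLinks i.1 i.2.2).count x ≤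
        ∑ s, ∑ w ∈ linkWords nu Γ m, (N.followLinks s w).count x := by
      rw [← Finset.sum_product']
      have hinj : Set.InjOn (fun i : V × V × List (Fin nu × Fin Γ) => (i.1, i.2.2)) I := by
        rintro ⟨s, t, w⟩ hi ⟨s', t', w'⟩ hi' h
        simp only [Prod.mk.injEq] at h
        obtain ⟨rfl, rfl⟩ := h
        have h2 := (hmem hi).2.symm.trans (hmem hi').2
        simp only at h2
        rw [h2]
      rw [← Finset.sum_image (f := fun i => (N.followLinks i.1 i.2).count x) hinj]
      refine Finset.sum_le_sum_of_subset fun j hj => ?_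
      obtain ⟨i, hi, rfl⟩ := Finset.mem_image.1 hj
      exact Finset.mem_product.2 ⟨Finset.mem_univ _, (hmem hi).1⟩
    rw [sum_count_followLinks m hx] at h1
    simp only [one_mul]
    exact_mod_cast h1
  obtain ⟨P, hP, hΛ, hlen⟩ := exists_scheme_of_family
    (S := I.image fun i => N.followLinks i.1 i.2.2) I (fun i => i.1) (fun i => i.2.1)
    (fun i => N.followLinks i.1 i.2.2) (fun _ => 1) (fun _ _ => zero_le_one)
    (fun i hi => ⟨Finset.mem_image_of_mem _ hi, hwalk i hi⟩) hq' htot hload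
  refine ⟨_, P, hP, hΛ, fun s t p hp => ?_⟩
  obtain ⟨i, hi, rfl⟩ := hlen s t p hp
  rw [length_followLinks, mem_linkWords.1 (hmem hi).1]

theorem exists_scheme_of_emulatesDeBruijn {d : ℕ} (hdB : N.EmulatesDeBruijn d) {m : ℕ}
    (hq : 0 < d ^ m / Fintype.card V) :
    ∃ S P, IsRoutingScheme N.graph S P ∧
      N.LoadLE S P ((m * (nu * Γ) ^ (m - 1) : ℕ) / ((d ^ m / Fintype.card V : ℕ) : ℝ)) ∧
      ∀ s t p, P s t p ≠ 0 → p.length = m := by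
  obtain ⟨φ, hφ⟩ := hdB
  refine exists_scheme_of_linkWords hq fun s t => ?_
  rw [card_linkWords_deBruijn hφ]
  exact div_le_card_filter_mod _ _ (φ t).2

theorem schemeSum_length_eq (hP : IsRoutingScheme N.graph S P) {m : ℕ}
    (h : ∀ s t p, P s t p ≠ 0 → p.length = m) :
    schemeSum S P (fun p => (p.length : ℝ)) = m * (Fintype.card V : ℝ) ^ 2 := by
  rw [schemeSum_congr (ψ := fun _ => (m : ℝ)) fun s t p hp => by rw [h s t p hp]]
  simp only [schemeSum, ← Finset.sum_mul, hP.total, Finset.sum_const, Finset.card_univ,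
    nsmul_eq_mul]
  ring

end MarsNetwork

/-! ### Bounds by logarithms and the main theorem -/

namespace MarsNetwork

variable {V : Type*} [Fintype V] [DecidableEq V] {nu Γ : ℕ} [NeZero Γ] {N : MarsNetwork V nu Γ}
  {S : Finset (List (Hop V))} {P : V → V → List (Hop V) → ℝ}

/-- Lower bound for the load of every routing scheme. -/
theorem mul_sub_le_load [Nonempty V] (hd : 1 < nu * Γ) {Λ : ℝ} (hP : IsRoutingScheme N.graph S P)
    (hΛ : N.LoadLE S P Λ) (K : ℕ) :
    (Fintype.card V : ℝ) * K - (nu * Γ : ℕ) * ((nu * Γ : ℕ) : ℝ) ^ K / (((nu * Γ : ℕ) : ℝ) - 1) ^ 2 ≤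
      (nu * Γ : ℕ) * Λ := by
  have hn : (0 : ℝ) < Fintype.card V := Nat.cast_pos.2 Fintype.card_pos
  have hd' : (1 : ℝ) < (nu * Γ : ℕ) := Nat.one_lt_cast.2 hd
  have h1 := (le_schemeSum_length hP K).trans (schemeSum_length_le hP hΛ)
  have h2 : (Fintype.card V : ℝ) * (∑ k ∈ Finset.range K,
      ((Fintype.card V : ℝ) - ∑ j ∈ Finset.range (k + 1), ((nu * Γ : ℕ) : ℝ) ^ j)) ≤
      Fintype.card V * ((nu * Γ : ℕ) * Λ) := h1.trans_eq (by ring)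
  have h3 := le_of_mul_le_mul_left h2 hn
  rw [Finset.sum_sub_distrib, Finset.sum_const, Finset.card_range, nsmul_eq_mul] at h3
  have h4 : ∑ k ∈ Finset.range K, ∑ j ∈ Finset.range (k + 1), ((nu * Γ : ℕ) : ℝ) ^ j ≤
      (nu * Γ : ℕ) * ((nu * Γ : ℕ) : ℝ) ^ K / (((nu * Γ : ℕ) : ℝ) - 1) ^ 2 := by
    rw [le_div_iff₀ (pow_pos (sub_pos.2 hd') 2), mul_comm]
    exact sq_mul_sum_geom_le hd' K
  linarith

end MarsNetwork

theorem mul_le_one_of_load {n d Λ X : ℝ} (hd : 0 < d) (hΛ : 0 < Λ) (h : n * X ≤ d * Λ) :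
    n / (2 * d * Λ) * (2 * X) ≤ 1 := by
  rw [div_mul_eq_mul_div, div_le_one (by positivity)]
  linarith

/-- Let `x` be the fractional part of `log_d n`, so that `d * d^K = n * d^(1-x)`. Bernoulli's
inequality for the exponent `1 - x` in `[0, 1]` gives `d^(1-x) ≤ 1 + (1-x)(d-1)`, and `d - 1 ≤
(d-1)^2` because `d ≥ 2`. The rounding error `x` then cancels. -/
theorem logb_sub_le {n d : ℝ} (hd : 2 ≤ d) (hn : 1 ≤ n) :
    n * (Real.logb d n - 1 - 1 / (d - 1) ^ 2) ≤
      n * ⌊Real.logb d n⌋₊ - d * d ^ ⌊Real.logb d n⌋₊ / (d - 1) ^ 2 := by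
  have hd1 : 0 < d - 1 := by linarith
  have hn0 : 0 < n := by linarith
  set K := ⌊Real.logb d n⌋₊ with hK
  have hlog : 0 ≤ Real.logb d n := Real.logb_nonneg (by linarith) hn
  have h1 : (K : ℝ) ≤ Real.logb d n := Nat.floor_le hlog
  have h2 : Real.logb d n < K + 1 := Nat.lt_floor_add_one _
  have h3 : d * d ^ K = n * d ^ (1 - (Real.logb d n - K)) := by
    rw [show 1 - (Real.logb d n - K) = 1 + K - Real.logb d n by ring,
      Real.rpow_sub (by linarith), Real.rpow_add (by linarith), Real.rpow_one, Real.rpow_natCast,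
      Real.rpow_logb (by linarith) (by linarith) hn0]
    field_simp
  have h4 := rpow_one_add_le_one_add_mul_self (s := d - 1) (p := 1 - (Real.logb d n - K))
    (by linarith) (by linarith) (by linarith)
  rw [add_sub_cancel] at h4
  have h5 : (1 - (Real.logb d n - K)) * (d - 1) ≤ (1 - (Real.logb d n - K)) * (d - 1) ^ 2 :=
    mul_le_mul_of_nonneg_left (by nlinarith) (by linarith)
  have h6 : d ^ (1 - (Real.logb d n - K)) / (d - 1) ^ 2 ≤
      1 / (d - 1) ^ 2 + (1 - (Real.logb d n - K)) := by
    rw [div_le_iff₀ (by positivity), add_mul, one_div, inv_mul_cancel₀ (by positivity)]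
    linarith
  rw [h3, mul_div_assoc, ← mul_sub]
  exact mul_le_mul_of_nonneg_left (by linarith) hn0.le

theorem theorem5 {V : Type*} [Fintype V] [DecidableEq V] {nu Γ : ℕ} [NeZero Γ]
    (N : MarsNetwork V nu Γ) (nt d : ℕ)
    (hnt : nt = Fintype.card V) (hnt2 : 2 ≤ nt) (hd : d = nu * Γ) (hd2 : 2 ≤ d)
    (D : ℕ) (hD : N.graph.EmulatedDiamLE D)
    (ε : ℝ) (hε : (D : ℝ) = Real.logb d nt + ε) :
    -- the maxima and the minimum in the definition of the worst-case throughput are attained,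
    -- and every saturated demand matrix is a worst case
    (∀ M, N.graph.IsSaturated M →
        IsGreatest (N.graph.vlbAchievable M) (N.graph.vlbThroughputFor M)) ∧
    IsLeast (N.graph.vlbThroughputFor '' {M | N.graph.IsSaturated M}) N.graph.vlbThroughput ∧
    (∀ M, N.graph.IsSaturated M → N.graph.vlbThroughputFor M = N.graph.vlbThroughput) ∧
    -- simple legs suffice for it
    (∀ M, N.graph.IsSaturated M → ∃ F : RouteFlow V, IsVLBFlow N.graph F ∧
        (∀ r ∈ F.support, r.HasSimpleLegs) ∧ N.graph.Serves F M N.graph.vlbThroughput) ∧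
    -- the throughput of every flow is at most the inverse of its average route length
    (∀ M, N.graph.IsSaturated M → ∀ (F : RouteFlow V) (θ : ℝ), IsVLBFlow N.graph F →
        N.graph.Serves F M θ → θ ≤ 1 / F.averageRouteLength M) ∧
    -- with equality for a flow that attains the worst-case throughput
    (∀ M, N.graph.IsSaturated M → ∃ F : RouteFlow V, IsVLBFlow N.graph F ∧
        N.graph.Serves F M N.graph.vlbThroughput ∧
        N.graph.vlbThroughput = 1 / F.averageRouteLength M) ∧
    -- approximation by `1 / (2 * log_d nt)`
    (1 - 1 / (d : ℝ)) * (d : ℝ) ^ (-ε) * (1 / (2 * (Real.logb d nt + ε))) ≤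
      N.graph.vlbThroughput ∧
    N.graph.vlbThroughput *
      (2 * (Real.logb d nt + ε) - 2 * (d : ℝ) ^ ε * (d / ((d : ℝ) - 1) ^ 2)) ≤ 1 ∧
    N.graph.vlbThroughput * (2 * Real.logb d nt - 2 - 2 / ((d : ℝ) - 1) ^ 2) ≤ 1 ∧
    -- sharper form for de Bruijn digraphs
    (N.EmulatesDeBruijn d →
      (∀ m : ℕ, 1 ≤ m → (((nt * (d ^ m / nt) : ℕ) : ℝ) / (d : ℝ) ^ m) * (1 / (2 * (m : ℝ))) ≤
        N.graph.vlbThroughput) ∧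
      ((∃ k : ℕ, nt = d ^ k) → ∀ M, N.graph.IsSaturated M → ∃ F : RouteFlow V,
        IsVLBFlow N.graph F ∧ N.graph.Serves F M (1 / (2 * Real.logb d nt)) ∧
        F.averageRouteLength M = 2 * Real.logb d nt)) := by
  have hd1 : (1 : ℝ) < d := Nat.one_lt_cast.2 hd2
  have hd0 : (0 : ℝ) < d := by linarith
  have hd' : 0 < nu * Γ := by omega
  have : Nontrivial V := Fintype.one_lt_card_iff_nontrivial.1 (by omega)
  have hn : (0 : ℝ) < nt := Nat.cast_pos.2 (by omega)
  obtain ⟨P₀, hP₀, hΛ₀⟩ := MarsNetwork.exists_simple_scheme_of_emulatedDiamLE hD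
  obtain ⟨P, Λ, hP, hΛ, hmin⟩ := MarsNetwork.exists_optimal_scheme hd' ⟨P₀, hP₀⟩
  have hΛ0 := MarsNetwork.loadLE_pos hP hΛ
  have hG {M} (hM : N.graph.IsSaturated M) := MarsNetwork.isGreatest_vlbAchievable hd' hP hΛ hmin hM
  rw [← hd, ← hnt] at hG
  have hfor {M} (hM : N.graph.IsSaturated M) : N.graph.vlbThroughputFor M = nt / (2 * d * Λ) :=
    (hG hM).csSup_eq
  obtain ⟨M₀, hM₀⟩ := N.exists_isSaturated
  have himage : N.graph.vlbThroughputFor '' {M | N.graph.IsSaturated M} = {nt / (2 * d * Λ)} := by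
    ext θ
    constructor
    · rintro ⟨M, hM, rfl⟩
      exact hfor hM
    · rintro rfl
      exact ⟨M₀, hM₀, hfor hM₀⟩
  have hθ : N.graph.vlbThroughput = nt / (2 * d * Λ) := by
    rw [PeriodicEvolvingGraph.vlbThroughput, himage, csInf_singleton]
  have hθ0 : (0 : ℝ) < nt / (2 * d * Λ) := by positivity
  -- The radius `K` at which distances are truncated is free: `K = D` gives the bound with `ε`, and
  -- `K = ⌊log_d nt⌋` the one without.
  have hld {K : ℕ} {X : ℝ} (hX : nt * X ≤ nt * K - d * (d : ℝ) ^ K / ((d : ℝ) - 1) ^ 2) :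
      (nt : ℝ) / (2 * d * Λ) * (2 * X) ≤ 1 := by
    have h := MarsNetwork.mul_sub_le_load (by omega) hP hΛ K
    rw [← hd, ← hnt] at h
    exact mul_le_one_of_load hd0 hΛ0 (hX.trans h)
  have hdε : (d : ℝ) ^ ε = (d : ℝ) ^ D / nt := by
    rw [show ε = D - Real.logb d nt by linarith, Real.rpow_sub hd0, Real.rpow_natCast,
      Real.rpow_logb hd0 hd1.ne' hn]
  rw [hθ]
  refine ⟨fun M hM => by rw [hfor hM]; exact hG hM, by rw [himage]; exact isLeast_singleton,
    fun M hM => hfor hM, fun M hM => ?_,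
    fun M hM F θ hF hS => MarsNetwork.le_inv_averageRouteLength hd' hM hF hS,
    fun M hM => ?_, ?_, ?_, ?_, fun hdB => ⟨fun m hm => ?_, ?_⟩⟩
  · obtain ⟨F, h1, h2, -, h3⟩ := MarsNetwork.exists_flow_of_scheme hP hΛ hd' hθ0
      (by rw [← hd, ← hnt]; exact le_of_eq (by field_simp)) hM
    refine ⟨F, h1, h3 fun s t p hp => ?_, h2⟩
    obtain ⟨h4, h5⟩ := hP.legal s t p hp
    exact h5.mem_simpleWalks.1 h4
  -- With all links full the total length is `Λ * nt * d`, which makes the average route length `2 d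
  -- Λ / nt`, the inverse of the throughput.
  · obtain ⟨S', P', hP', htight⟩ := MarsNetwork.exists_tight_scheme hP hΛ fun s => by
      rw [MarsNetwork.simple_scheme_self hP]
      exact one_pos
    obtain ⟨F, h1, h2, h3, -⟩ := MarsNetwork.exists_flow_of_scheme hP'
      (fun x hx => (htight x hx).le) hd' hθ0
      (by rw [← hd, ← hnt]; exact le_of_eq (by field_simp)) hM
    refine ⟨F, h1, h2, ?_⟩
    have h4 : schemeSum S' P' (fun p => (p.length : ℝ)) = Λ * (nt * d) := by
      rw [MarsNetwork.schemeSum_length hP', hnt, hd, ← Nat.cast_mul,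
        ← MarsNetwork.sum_linkCount (N := N), Nat.cast_sum, Finset.mul_sum]
      exact Finset.sum_congr rfl fun x hx => htight x (mem_hopSet.1 hx)
    rw [h3, h4, ← hnt]
    field_simp
  · have h1 : Λ ≤ ∑ k ∈ Finset.range (D + 1), (k : ℝ) * (d : ℝ) ^ (k - 1) := by
      refine (hmin _ _ hP₀ hΛ₀).trans_eq ?_
      rw [hd]
      push_cast
      rfl
    have h2 : ((d : ℝ) - 1) * Λ ≤ D * (d : ℝ) ^ D :=
      (mul_le_mul_of_nonneg_left h1 (by linarith)).trans (sub_one_mul_sum_le hd1.le D)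
    have hD0 : (0 : ℝ) < D := by
      have h3 := (mul_pos (sub_pos.2 hd1) hΛ0).trans_le h2
      exact pos_of_mul_pos_left h3 (by positivity)
    rw [← hε, Real.rpow_neg hd0.le, hdε]
    calc _ = nt * (((d : ℝ) - 1) * Λ) / (2 * d * Λ * (D * (d : ℝ) ^ D)) := by field_simp
      _ ≤ nt * (D * (d : ℝ) ^ D) / (2 * d * Λ * (D * (d : ℝ) ^ D)) := by gcongr
      _ = _ := by field_simp
  · rw [← hε, hdε]
    have h1 := hld (K := D) (X := D - (d : ℝ) ^ D / nt * (d / ((d : ℝ) - 1) ^ 2))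
      (le_of_eq (by field_simp))
    refine (le_of_eq ?_).trans h1
    ring
  · have h1 := hld (logb_sub_le (n := nt) (by exact_mod_cast hd2) (by exact_mod_cast by omega))
    refine (le_of_eq ?_).trans h1
    ring
  -- If `d ^ m < nt`, the claimed bound is `0`.
  · rcases Nat.eq_zero_or_pos (d ^ m / nt) with hq | hq
    · rw [hq, mul_zero, Nat.cast_zero, zero_div, zero_mul]
      exact hθ0.le
    have hq' : (0 : ℝ) < (d ^ m / nt : ℕ) := Nat.cast_pos.2 hq
    have hm0 : (0 : ℝ) < m := Nat.cast_pos.2 hm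
    rw [hnt] at hq
    obtain ⟨S', P', hP', hΛ', -⟩ := MarsNetwork.exists_scheme_of_emulatesDeBruijn hdB hq
    rw [← hnt, ← hd] at hΛ'
    rw [Nat.cast_mul]
    obtain ⟨F, h1, h2, -⟩ := MarsNetwork.exists_flow_of_scheme hP' hΛ' hd'
      (θ := nt * (d ^ m / nt : ℕ) / (d : ℝ) ^ m * (1 / (2 * (m : ℝ)))) (by positivity) (by
        rw [← hd, ← hnt]
        obtain ⟨k, rfl⟩ : ∃ k, m = k + 1 := ⟨m - 1, by omega⟩
        rw [Nat.add_sub_cancel]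
        push_cast at hm0 hq' ⊢
        refine le_of_eq ?_
        field_simp
        ring) hM₀
    exact (hG hM₀).2 ⟨F, h1, h2⟩
  · rintro ⟨k, hk⟩ M hM
    have hlog : Real.logb d nt = k := by
      rw [hk, Nat.cast_pow, Real.logb_pow, Real.logb_self_eq_one hd1, mul_one]
    have hk0 : k ≠ 0 := by
      rintro rfl
      rw [pow_zero] at hk
      omega
    have hk1 : (0 : ℝ) < k := Nat.cast_pos.2 (Nat.pos_of_ne_zero hk0)
    -- With `m = k` the scheme has load `k d^(k-1)` and uses only walks of length `k`, so every
    -- route has exactly `2 k` hops.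
    have hq : d ^ k / nt = 1 := by rw [← hk, Nat.div_self (by omega)]
    obtain ⟨S', P', hP', hΛ', hlen⟩ := MarsNetwork.exists_scheme_of_emulatesDeBruijn hdB
      (m := k) (by rw [← hnt, hq]; exact one_pos)
    rw [← hnt, ← hd, hq, Nat.cast_one, div_one] at hΛ'
    rw [hlog]
    obtain ⟨F, h1, h2, h3, -⟩ := MarsNetwork.exists_flow_of_scheme hP' hΛ' hd'
      (θ := 1 / (2 * (k : ℝ))) (by positivity) (by
        rw [← hd, ← hnt, hk]
        obtain ⟨j, rfl⟩ := Nat.exists_eq_succ_of_ne_zero hk0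
        rw [Nat.succ_eq_add_one, Nat.add_sub_cancel]
        push_cast at hk1 ⊢
        refine le_of_eq ?_
        field_simp
        ring) hM
    refine ⟨F, h1, h2, ?_⟩
    rw [h3, MarsNetwork.schemeSum_length_eq hP' hlen, ← hnt]
    field_simp
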